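/- Setting. A Carnot group $G$ is a simply connected Lie group whose Lie algebra has a stratification $\mathfrak g=V_1\oplus\cdots\oplus V_s$, $V_{r+1}=[V_1,V_r]$ for $1\le r\le s$, $V_{s+1}=0$, together with an inner product on $V_1$. It is taken in coordinates adapted to the stratification: $G=\mathbb R^n$ with a smooth group law with identity $0$, $\mathfrak g=T_0G=\mathbb R^n$, each coordinate vector $e_i$ lies in one layer $V_{w_i}$, $V_r=\operatorname{span}\{e_i: w_i=r\}$, the $e_i$ with $w_i=1$ are orthonormal, and the dilations $(\delta_\lambda x)_i=\lambda^{w_i}x_i$, $\lambda>0$, are automorphisms of $G$ (exponential coordinates with respect to a basis adapted to the layers and orthonormal on $V_1$ are of this kind). Assume $n\ge 1$ and put $n_h=\sum_{r} r\dim V_r$. Let $X_1,\dots,X_{k_1}$ be the left-invariant vector fields extending the orthonormal basis of $V_1$, and for $f:G\to\mathbb R^D$ of class $C^k$ let $\nabla^kf=(X_{i_1}\cdots X_{i_k}f)_{1\le i_1,\dots,i_k\le k_1}$ be the $k$-th iterated horizontal gradient, $|\nabla^k f(p)|$ its Euclidean norm, and $\|\nabla^kf\|_{C^0}=\sup_{p\in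 G}|\nabla^kf(p)|$. Theorem 4.3 ($C^j$-lifting). Let $G$ be such a Carnot group and let $m\ge1$, $j\ge1$ be integers. There is a constant $C=C(G,m,j)$ such that the following holds. Let $D$ be an integer with $D-m\ge 2^{4n_h+7}n_h$, and let $R_1,\dots,R_j$ be positive reals that are log-concave in the sense that $R_aR_b\ge R_{a+b}$ whenever $a,b\ge1$ and $a+b\le j$. Let $v_1,\dots,v_m:G\to\mathbb S^{D-1}\subset\mathbb R^D$ be maps of class $C^j$ that form an orthonormal system at each point and satisfy $$\sum_{k=1}^jR_k\|\nabla^kv_i\|_{C^0}\le1,\qquad i=1,\dots,m.$$ Then there is a map $v_{m+1}:G\to\mathbb S^{D-1}$ of class $C^j$ such that $v_1,\dots,v_m,v_{m+1}$ form an orthonormal system at each point and $$\sum_{k=1}^jR_k\|\nabla^kv_{m+1}\|_{C^0}\le C.$$ -/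

import Mathlib

open scoped ContDiff ENNReal NNReal

noncomputable section

/-- A Lie group whose underlying manifold is `ℝⁿ` (with its standard smooth structure) and whose
identity element is the origin. -/
structure LieGroupLaw (n : ℕ) where
  /-- the group multiplication -/
  mul : (Fin n → ℝ) → (Fin n → ℝ) → (Fin n → ℝ)
  /-- the group inverse -/
  inv : (Fin n → ℝ) → (Fin n → ℝ)
  mul_assoc : ∀ x y z, mul (mul x y) z = mul x (mul y z)
  zero_mul : ∀ x, mul 0 x = x
  mul_zero : ∀ x, mul x 0 = x
  inv_mul : ∀ x, mul (inv x) x = 0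
  contDiff_mul : ContDiff ℝ ∞ (fun p : (Fin n → ℝ) × (Fin n → ℝ) => mul p.1 p.2)
  contDiff_inv : ContDiff ℝ ∞ inv

namespace LieGroupLaw

variable {n : ℕ}

/-- The left-invariant vector field on the group with value `x` at the identity:
`p ↦ (dL_p)_e x`, where `L_p` is left multiplication by `p`. -/
def leftInvariantField (G : LieGroupLaw n) (x : Fin n → ℝ) : (Fin n → ℝ) → (Fin n → ℝ) :=
  fun p => fderiv ℝ (fun q => G.mul p q) 0 x

/-- The Lie bracket on the Lie algebra `𝔤 = T_e G = ℝⁿ`: the value at the identity of the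
commutator of the associated left-invariant vector fields. -/
def bracket (G : LieGroupLaw n) (x y : Fin n → ℝ) : Fin n → ℝ :=
  VectorField.lieBracket ℝ (G.leftInvariantField x) (G.leftInvariantField y) 0

end LieGroupLaw

/-- The subspace `V_r` of `ℝⁿ` spanned by the coordinate vectors of weight `r`. -/
def weightLayer {n : ℕ} (weight : Fin n → ℕ) (r : ℕ) : Submodule ℝ (Fin n → ℝ) :=
  Submodule.span ℝ {x | ∃ i, weight i = r ∧ x = Pi.single i 1}

/-- The dilation `δ_lam`, acting on `V_r` as multiplication by `lam ^ r`. -/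
def weightDilation {n : ℕ} (weight : Fin n → ℕ) (lam : ℝ) (x : Fin n → ℝ) : Fin n → ℝ :=
  fun i => lam ^ weight i * x i

/-- A (sub-Riemannian) Carnot group, in coordinates adapted to its stratification.

The underlying Lie group is `ℝⁿ` with a smooth group law (so it is simply connected), and its Lie
algebra `𝔤 = T_e G = ℝⁿ` is stratified: `𝔤 = V_1 ⊕ V_2 ⊕ ⋯` with `V_{r+1} = [V_1, V_r]` for
`r ≥ 1`, where `V_r` is spanned by the coordinate vectors of weight `r`.  Since there are finitely
many weights, `V_r = 0` for all large `r`.  The dilations `δ_lam`, `lam > 0`, given by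
`δ_lam = lam ^ r` on `V_r`, are automorphisms of the group.  The inner product on `V_1` is the one
for which the coordinate vectors of weight `1` are orthonormal. -/
structure CarnotGroup (n : ℕ) extends LieGroupLaw n where
  /-- the index of the layer to which each coordinate vector belongs -/
  weight : Fin n → ℕ
  weight_pos : ∀ i, 1 ≤ weight i
  stratified : ∀ r, 1 ≤ r → weightLayer weight (r + 1) =
    Submodule.span ℝ {z | ∃ x ∈ weightLayer weight 1, ∃ y ∈ weightLayer weight r,
      z = toLieGroupLaw.bracket x y}
  dilation_mul : ∀ lam : ℝ, 0 < lam → ∀ x y, weightDilation weight lam (mul x y) =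
    mul (weightDilation weight lam x) (weightDilation weight lam y)

namespace CarnotGroup

variable {n : ℕ} {F : Type*} [NormedAddCommGroup F] [NormedSpace ℝ F]

/-- The Hausdorff dimension `n_h = ∑_r r · dim V_r`. -/
def homogeneousDim (G : CarnotGroup n) : ℕ := ∑ i, G.weight i

/-- The indices of the orthonormal basis of `V_1`. -/
abbrev HorizontalIndex (G : CarnotGroup n) : Type := {i : Fin n // G.weight i = 1}

/-- The horizontal derivative `X_i f`, where `X_i` is the left-invariant vector field extending the
`i`-th vector of the orthonormal basis of `V_1`. -/
def horizontalDeriv (G : CarnotGroup n) (i : G.HorizontalIndex) (f : (Fin n → ℝ) → F) :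
    (Fin n → ℝ) → F :=
  fun p => fderiv ℝ f p (G.leftInvariantField (Pi.single i.1 1) p)

/-- The iterated horizontal derivative `X_{I 0} X_{I 1} ⋯ X_{I (k-1)} f`; these are the components
of `∇^k f`. -/
def wordDeriv (G : CarnotGroup n) :
    {k : ℕ} → (Fin k → G.HorizontalIndex) → ((Fin n → ℝ) → F) → ((Fin n → ℝ) → F)
  | 0, _, f => f
  | _ + 1, I, f => G.horizontalDeriv (I 0) (G.wordDeriv (fun l => I l.succ) f)

/-- The Euclidean norm `|∇^k f(p)|` of the `k`-th iterated horizontal gradient. -/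
def gradNorm (G : CarnotGroup n) (k : ℕ) (f : (Fin n → ℝ) → F) (p : Fin n → ℝ) : ℝ :=
  √(∑ I : Fin k → G.HorizontalIndex, ‖G.wordDeriv I f p‖ ^ 2)

/-- `‖∇^k f‖_{C^0} = sup_p |∇^k f(p)|`, as an extended nonnegative real number. -/
def supGradNorm (G : CarnotGroup n) (k : ℕ) (f : (Fin n → ℝ) → F) : ℝ≥0∞ :=
  ⨆ p, ENNReal.ofReal (G.gradNorm k f p)

/-- `∑_{k=1}^j R_k ‖∇^k f‖_{C^0}`, as an extended nonnegative real number. -/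
def scaledNorm (G : CarnotGroup n) (R : ℕ → ℝ) (j : ℕ) (f : (Fin n → ℝ) → F) : ℝ≥0∞ :=
  ∑ k ∈ Finset.Icc 1 j, ENNReal.ofReal (R k) * G.supGradNorm k f

end CarnotGroup

/-- `R_1, …, R_j` is a log-concave sequence of positive reals: `R_a R_b ≥ R_{a+b}` whenever
`a, b ≥ 1` and `a + b ≤ j`. -/
def IsLogConcaveScales (R : ℕ → ℝ) (j : ℕ) : Prop :=
  (∀ k, 1 ≤ k → k ≤ j → 0 < R k) ∧
    ∀ a b, 1 ≤ a → 1 ≤ b → a + b ≤ j → R (a + b) ≤ R a * R b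

end

/-! Cover `G` by balls of radius `ρ = ε R₁` around a `ρ`-separated net. Across such a ball each
`v_i` turns only by `O(ε)`. To each net point `α` attach one fixed unit vector `u_α`, orthogonal to
all `v_i(α)` and to the vectors of the nearby net points. Only `9 ^ n_h` net points are nearby, so a
greedy choice succeeds once `D > m + 9 ^ n_h`. With bumps `ψ_α` at scale `ρ`, the field `x = ∑ ψ_α
u_α` has length at least one, since the vectors active at a point are orthonormal and one
coefficient is 1. It is also almost orthogonal to every `v_i`. Subtracting its projection on the
`v_i` and normalising gives `v_{m+1}`.

The estimates rest on submultiplicativity of the scales. `R_b ≤ R₁ ^ b` makes the bumps cost only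
powers of `ε⁻¹`, and `R_{a+b} ≤ R_a R_b` keeps the bounds stable under products and under `t ↦ t ^
(-1/2)`. The constants are fixed before `D`, `R` and `v`.

The metric is the one dual to `C¹` functions with horizontal derivatives at most 1, so estimates on
functions need no curves. Its balls are compact by testing against a bump, and neighbourhoods of the
identity by bracket generation and Baire (`dualBall_mem_nhds`). Left translations preserve volume
and dilations scale it by `λ ^ n_h`, whence the packing bound `IsSeparatedAt.card_le`. The field `x`
is built in `exists_almost_orthogonal_field`. -/

noncomputable section

open Filter Topology

/-! ### Group identities and left-invariant fields. -/

namespace LieGroupLaw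

variable {n : ℕ} (G : LieGroupLaw n)

theorem mul_inv (x : Fin n → ℝ) : G.mul x (G.inv x) = 0 := by
  calc G.mul x (G.inv x)
      = G.mul (G.mul (G.inv (G.inv x)) (G.inv x)) (G.mul x (G.inv x)) := by
        rw [G.inv_mul, G.zero_mul]
    _ = 0 := by
        rw [G.mul_assoc, ← G.mul_assoc (G.inv x) x, G.inv_mul, G.zero_mul, G.inv_mul]

theorem inv_mul_cancel_left (x y : Fin n → ℝ) : G.mul (G.inv x) (G.mul x y) = y := by
  rw [← G.mul_assoc, G.inv_mul, G.zero_mul]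

theorem mul_inv_cancel_left (x y : Fin n → ℝ) : G.mul x (G.mul (G.inv x) y) = y := by
  rw [← G.mul_assoc, G.mul_inv, G.zero_mul]

theorem mul_left_injective (x : Fin n → ℝ) : Function.Injective (G.mul x) :=
  Function.LeftInverse.injective (G.inv_mul_cancel_left x)

theorem contDiff_mul_left (p : Fin n → ℝ) : ContDiff ℝ ∞ (G.mul p) :=
  G.contDiff_mul.comp (contDiff_const.prodMk contDiff_id)

theorem differentiable_mul_left (p : Fin n → ℝ) : Differentiable ℝ (G.mul p) :=
  (G.contDiff_mul_left p).differentiable (by simp)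

theorem continuous_mul_left (p : Fin n → ℝ) : Continuous (G.mul p) :=
  (G.contDiff_mul_left p).continuous

theorem hasFDerivAt_mul (z : (Fin n → ℝ) × (Fin n → ℝ)) :
    HasFDerivAt (fun z : (Fin n → ℝ) × (Fin n → ℝ) => G.mul z.1 z.2)
      (fderiv ℝ (fun z : (Fin n → ℝ) × (Fin n → ℝ) => G.mul z.1 z.2) z) z :=
  ((G.contDiff_mul.differentiable (by simp)) z).hasFDerivAt

theorem leftInvariantField_eq (x p : Fin n → ℝ) :
    G.leftInvariantField x p =
      fderiv ℝ (fun z : (Fin n → ℝ) × (Fin n → ℝ) => G.mul z.1 z.2) (p, 0) (0, x) := by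
  have h := (G.hasFDerivAt_mul (p, 0)).comp (0 : Fin n → ℝ)
    ((hasFDerivAt_const p (0 : Fin n → ℝ)).prodMk (hasFDerivAt_id (0 : Fin n → ℝ)))
  have h2 : HasFDerivAt (fun q => G.mul p q) _ 0 := h
  rw [leftInvariantField, h2.fderiv]
  simp

theorem contDiff_leftInvariantField (x : Fin n → ℝ) : ContDiff ℝ ∞ (G.leftInvariantField x) := by
  have : G.leftInvariantField x = fun p =>
      fderiv ℝ (fun z : (Fin n → ℝ) × (Fin n → ℝ) => G.mul z.1 z.2) (p, 0) (0, x) :=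
    funext (G.leftInvariantField_eq x)
  rw [this]
  have h : ContDiff ℝ ∞ (fderiv ℝ (fun z : (Fin n → ℝ) × (Fin n → ℝ) => G.mul z.1 z.2)) :=
    G.contDiff_mul.fderiv_right (by simp)
  exact (h.comp (contDiff_id.prodMk contDiff_const)).clm_apply contDiff_const

/-- Differentiate `L_p ∘ L_q = L_{pq}` at the identity. -/
theorem fderiv_mul_left_leftInvariantField (x p q : Fin n → ℝ) :
    fderiv ℝ (G.mul p) q (G.leftInvariantField x q) = G.leftInvariantField x (G.mul p q) := by
  have h1 : HasFDerivAt (G.mul q) (fderiv ℝ (G.mul q) 0) 0 :=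
    (G.differentiable_mul_left q 0).hasFDerivAt
  have h2 : HasFDerivAt (G.mul p) (fderiv ℝ (G.mul p) q) (G.mul q 0) := by
    rw [G.mul_zero]; exact (G.differentiable_mul_left p q).hasFDerivAt
  have h3 := h2.comp 0 h1
  have h4 : (G.mul p) ∘ (G.mul q) = G.mul (G.mul p q) := by
    ext1 s; simp [G.mul_assoc]
  rw [h4] at h3
  simp only [leftInvariantField]
  rw [show (fun r => G.mul (G.mul p q) r) = G.mul (G.mul p q) from rfl, h3.fderiv]
  rfl

end LieGroupLaw

/-! ### Dilations and translations acting on horizontal derivatives. -/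

/-- The dilation as a continuous linear map. -/
def weightDilationCLM {n : ℕ} (weight : Fin n → ℕ) (lam : ℝ) : (Fin n → ℝ) →L[ℝ] (Fin n → ℝ) :=
  ContinuousLinearMap.pi fun i => lam ^ weight i • ContinuousLinearMap.proj i

theorem coe_weightDilationCLM {n : ℕ} (weight : Fin n → ℕ) (lam : ℝ) :
    ⇑(weightDilationCLM weight lam) = weightDilation weight lam := by
  ext x i; simp [weightDilationCLM, weightDilation]

theorem weightDilation_mul_mul {n : ℕ} (weight : Fin n → ℕ) (a b : ℝ) (x : Fin n → ℝ) :
    weightDilation weight a (weightDilation weight b x) = weightDilation weight (a * b) x := by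
  ext i; simp [weightDilation, mul_pow]; ring

theorem weightDilation_one {n : ℕ} (weight : Fin n → ℕ) (x : Fin n → ℝ) :
    weightDilation weight 1 x = x := by
  ext i; simp [weightDilation]

theorem weightDilation_zero {n : ℕ} (weight : Fin n → ℕ) (a : ℝ) :
    weightDilation weight a 0 = 0 := by
  ext i; simp [weightDilation]

theorem contDiff_weightDilation {n : ℕ} (weight : Fin n → ℕ) (a : ℝ) :
    ContDiff ℝ ∞ (weightDilation weight a) := by
  rw [← coe_weightDilationCLM]; exact ContinuousLinearMap.contDiff _

namespace CarnotGroup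

variable {n : ℕ} {F : Type*} [NormedAddCommGroup F] [NormedSpace ℝ F] (G : CarnotGroup n)

theorem hasFDerivAt_weightDilation (lam : ℝ) (x : Fin n → ℝ) :
    HasFDerivAt (weightDilation G.weight lam) (weightDilationCLM G.weight lam) x := by
  rw [← coe_weightDilationCLM]; exact ContinuousLinearMap.hasFDerivAt _

theorem horizontalDeriv_comp_mul_left (i : G.HorizontalIndex) {f : (Fin n → ℝ) → F}
    (hf : Differentiable ℝ f) (p : Fin n → ℝ) :
    G.horizontalDeriv i (fun q => f (G.mul p q)) = fun q => G.horizontalDeriv i f (G.mul p q) := by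
  ext1 q
  have h := (hf (G.mul p q)).hasFDerivAt.comp q (G.differentiable_mul_left p q).hasFDerivAt
  simp only [horizontalDeriv]
  rw [show (fun q => f (G.mul p q)) = f ∘ G.mul p from rfl, h.fderiv]
  simp [G.fderiv_mul_left_leftInvariantField]

theorem weightDilation_single (i : G.HorizontalIndex) (lam : ℝ) :
    weightDilation G.weight lam (Pi.single i.1 1) = lam • Pi.single i.1 1 := by
  ext k
  by_cases h : k = i.1
  · subst h; simp [weightDilation, i.2]
  · simp [weightDilation, h]

theorem weightDilation_leftInvariantField {lam : ℝ} (hl : 0 < lam) (x p : Fin n → ℝ) :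
    weightDilation G.weight lam (G.leftInvariantField x p) =
      G.leftInvariantField (weightDilation G.weight lam x) (weightDilation G.weight lam p) := by
  have h1 := (G.hasFDerivAt_weightDilation lam (G.mul p 0)).comp 0
    (G.differentiable_mul_left p 0).hasFDerivAt
  have h0 : HasFDerivAt (G.mul (weightDilation G.weight lam p))
      (fderiv ℝ (G.mul (weightDilation G.weight lam p)) 0) (weightDilation G.weight lam 0) := by
    rw [weightDilation_zero]; exact (G.differentiable_mul_left _ 0).hasFDerivAt
  have h2 := h0.comp 0 (G.hasFDerivAt_weightDilation lam 0)
  have h3 : weightDilation G.weight lam ∘ G.mul p =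
      G.mul (weightDilation G.weight lam p) ∘ weightDilation G.weight lam := by
    ext1 s; simp [G.dilation_mul lam hl]
  rw [h3] at h1
  have h4 := DFunLike.congr_fun (h1.unique h2) x
  simpa [coe_weightDilationCLM, LieGroupLaw.leftInvariantField] using h4

theorem leftInvariantField_smul (c : ℝ) (x p : Fin n → ℝ) :
    G.leftInvariantField (c • x) p = c • G.leftInvariantField x p := by
  simp [LieGroupLaw.leftInvariantField]

theorem horizontalDeriv_comp_weightDilation (i : G.HorizontalIndex) {f : (Fin n → ℝ) → F}
    (hf : Differentiable ℝ f) {lam : ℝ} (hl : 0 < lam) :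
    G.horizontalDeriv i (fun q => f (weightDilation G.weight lam q)) =
      fun q => lam • G.horizontalDeriv i f (weightDilation G.weight lam q) := by
  ext1 q
  have h := (hf (weightDilation G.weight lam q)).hasFDerivAt.comp q
    (G.hasFDerivAt_weightDilation lam q)
  simp only [horizontalDeriv]
  rw [show (fun q => f (weightDilation G.weight lam q)) = f ∘ weightDilation G.weight lam from rfl,
    h.fderiv]
  simp [coe_weightDilationCLM, G.weightDilation_leftInvariantField hl, G.weightDilation_single,
    G.leftInvariantField_smul]

theorem contDiff_horizontalDeriv (i : G.HorizontalIndex) {f : (Fin n → ℝ) → F} {k : ℕ}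
    (hf : ContDiff ℝ (k + 1) f) : ContDiff ℝ k (G.horizontalDeriv i f) := by
  have h1 : ContDiff ℝ k (fderiv ℝ f) := hf.fderiv_right (by norm_cast)
  exact h1.clm_apply ((G.contDiff_leftInvariantField _).of_le (by exact_mod_cast le_top))

theorem horizontalDeriv_const_smul (i : G.HorizontalIndex) (c : ℝ) {f : (Fin n → ℝ) → F}
    (hf : Differentiable ℝ f) :
    G.horizontalDeriv i (fun q => c • f q) = fun q => c • G.horizontalDeriv i f q := by
  ext1 q
  simp only [horizontalDeriv]
  rw [fderiv_fun_const_smul (hf q)]; rfl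

/-! ### Homogeneous balls -/

/-- Continuously differentiable functions whose horizontal derivatives are bounded by one. -/
def IsHorizontallyLipschitz (f : (Fin n → ℝ) → ℝ) : Prop :=
  ContDiff ℝ 1 f ∧ ∀ i p, |G.horizontalDeriv i f p| ≤ 1

/-- The closed ball of radius `r` about the identity, for the left-invariant distance dual to the
horizontally Lipschitz functions. -/
def dualBall (r : ℝ) : Set (Fin n → ℝ) :=
  {x | ∀ f, G.IsHorizontallyLipschitz f → |f x - f 0| ≤ r}

variable {G}

theorem IsHorizontallyLipschitz.comp_mul_left {f : (Fin n → ℝ) → ℝ}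
    (hf : G.IsHorizontallyLipschitz f) (p : Fin n → ℝ) :
    G.IsHorizontallyLipschitz (fun q => f (G.mul p q)) := by
  refine ⟨hf.1.comp ((G.contDiff_mul_left p).of_le (by exact_mod_cast le_top)), fun i q => ?_⟩
  rw [G.horizontalDeriv_comp_mul_left i (hf.1.differentiable (by simp)) p]
  exact hf.2 i _

theorem IsHorizontallyLipschitz.abs_sub_le {f : (Fin n → ℝ) → ℝ}
    (hf : G.IsHorizontallyLipschitz f) {r : ℝ} {p x : Fin n → ℝ} (hx : x ∈ G.dualBall r) :
    |f (G.mul p x) - f p| ≤ r := by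
  simpa [G.mul_zero] using hx _ (hf.comp_mul_left p)

theorem mul_mem_dualBall {r s : ℝ} {x y : Fin n → ℝ} (hx : x ∈ G.dualBall r)
    (hy : y ∈ G.dualBall s) : G.mul x y ∈ G.dualBall (r + s) := by
  intro f hf
  have h1 := hx f hf
  have h2 := hf.abs_sub_le (p := x) hy
  calc |f (G.mul x y) - f 0| = |(f x - f 0) + (f (G.mul x y) - f x)| := by ring_nf
    _ ≤ _ := (abs_add_le _ _).trans (add_le_add h1 h2)

theorem inv_mem_dualBall {r : ℝ} {x : Fin n → ℝ} (hx : x ∈ G.dualBall r) :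
    G.inv x ∈ G.dualBall r := by
  intro f hf
  have h2 := hf.abs_sub_le (p := G.inv x) hx
  rwa [G.inv_mul, abs_sub_comm] at h2

theorem inv_mul_mem_dualBall_comm {r : ℝ} {x y : Fin n → ℝ}
    (h : G.mul (G.inv x) y ∈ G.dualBall r) : G.mul (G.inv y) x ∈ G.dualBall r := by
  have h1 := inv_mem_dualBall h
  convert h1 using 1
  apply G.mul_left_injective (G.mul (G.inv x) y)
  rw [G.mul_inv, G.mul_assoc, G.mul_inv_cancel_left, G.inv_mul]

theorem inv_mul_mem_dualBall_trans {r s : ℝ} {x y z : Fin n → ℝ}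
    (h : G.mul (G.inv x) y ∈ G.dualBall r) (h' : G.mul (G.inv y) z ∈ G.dualBall s) :
    G.mul (G.inv x) z ∈ G.dualBall (r + s) := by
  have := mul_mem_dualBall h h'
  rwa [G.mul_assoc, G.mul_inv_cancel_left] at this

theorem dualBall_mono {r s : ℝ} (h : r ≤ s) : G.dualBall r ⊆ G.dualBall s :=
  fun _ hx f hf => (hx f hf).trans h

theorem zero_mem_dualBall {r : ℝ} (h : 0 ≤ r) : (0 : Fin n → ℝ) ∈ G.dualBall r := by
  intro f _; simpa using h

theorem isClosed_dualBall (r : ℝ) : IsClosed (G.dualBall r) := by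
  have : G.dualBall r = ⋂ f, ⋂ (_ : G.IsHorizontallyLipschitz f), {x | |f x - f 0| ≤ r} := by
    ext x; simp [dualBall]
  rw [this]
  exact isClosed_iInter fun f => isClosed_iInter fun hf =>
    isClosed_le ((hf.1.continuous.sub continuous_const).abs) continuous_const

/-- Horizontal fields have weight one, so `lam⁻¹ • f ∘ δ_lam` is again a test function whenever `f`
is. -/
theorem weightDilation_mem_dualBall {r lam : ℝ} (hl : 0 < lam) {x : Fin n → ℝ}
    (hx : x ∈ G.dualBall r) : weightDilation G.weight lam x ∈ G.dualBall (lam * r) := by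
  intro f hf
  have hd := hf.1.differentiable (by simp)
  have hfd : ContDiff ℝ 1 (fun q => f (weightDilation G.weight lam q)) :=
    hf.1.comp ((contDiff_weightDilation _ _).of_le (by exact_mod_cast le_top))
  have h : G.IsHorizontallyLipschitz
      (fun q => lam⁻¹ • f (weightDilation G.weight lam q)) := by
    refine ⟨hfd.const_smul _, fun i q => ?_⟩
    rw [G.horizontalDeriv_const_smul i _ (hfd.differentiable (by simp)),
      G.horizontalDeriv_comp_weightDilation i hd hl]
    simpa [hl.ne'] using hf.2 i _
  have h2 := hx _ h
  simp only [weightDilation_zero, smul_eq_mul, ← mul_sub] at h2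
  rw [abs_mul, abs_inv, abs_of_pos hl] at h2
  rwa [inv_mul_le_iff₀ hl] at h2

theorem weightDilation_mem_dualBall_iff {r lam : ℝ} (hl : 0 < lam) {x : Fin n → ℝ} :
    weightDilation G.weight lam x ∈ G.dualBall (lam * r) ↔ x ∈ G.dualBall r := by
  refine ⟨fun h => ?_, weightDilation_mem_dualBall hl⟩
  have := weightDilation_mem_dualBall (inv_pos.2 hl) h
  rwa [weightDilation_mul_mul, ← mul_assoc, inv_mul_cancel₀ hl.ne', weightDilation_one,
    one_mul] at this

/-- A bump divided by a bound `M` for its horizontal derivatives is a test function that drops by `1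
/ M` outside its support. Hence the dual ball of radius `1 / (2M)` is Euclidean bounded, and
dilations carry this to every radius. -/
theorem isCompact_dualBall (r : ℝ) : IsCompact (G.dualBall r) := by
  obtain ⟨ψ⟩ : Nonempty (ContDiffBump (0 : Fin n → ℝ)) := inferInstance
  have hc : ∀ i : G.HorizontalIndex, ∃ C, ∀ p, ‖G.horizontalDeriv i ψ p‖ ≤ C := by
    intro i
    have h1 : Continuous (G.horizontalDeriv i ψ) :=
      (G.contDiff_horizontalDeriv (k := 0) i ψ.contDiff).continuous
    have h2 : HasCompactSupport (fderiv ℝ ψ) := ψ.hasCompactSupport.fderiv ℝ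
    have h3 : HasCompactSupport (G.horizontalDeriv i ψ) :=
      h2.mono fun x hx hx' => hx (by simp [horizontalDeriv, hx'])
    exact h3.exists_bound_of_continuous h1
  choose C hC using hc
  set M : ℝ := 1 + ∑ i, |C i| with hM
  have hM0 : 0 < M := by positivity
  have hCM : ∀ i, C i ≤ M := fun i => by
    have : |C i| ≤ ∑ i, |C i| :=
      Finset.single_le_sum (f := fun i => |C i|) (fun _ _ => abs_nonneg _) (Finset.mem_univ i)
    linarith [le_abs_self (C i)]
  have hL : G.IsHorizontallyLipschitz (fun q => M⁻¹ • ψ q) := by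
    refine ⟨ψ.contDiff.const_smul _, fun i q => ?_⟩
    rw [G.horizontalDeriv_const_smul i _ ((ψ.contDiff (n := 1)).differentiable (by simp))]
    simp only [smul_eq_mul]
    rw [abs_mul, abs_inv, abs_of_pos hM0, inv_mul_le_iff₀ hM0, mul_one]
    exact (hC i q).trans (hCM i)
  have hsmall : ∀ x ∈ G.dualBall ((2 * M)⁻¹), x ∈ Metric.closedBall (0 : Fin n → ℝ) ψ.rOut := by
    intro x hx
    by_contra hx'
    have h0 : ψ x = 0 := ψ.zero_of_le_dist (by
      rw [Metric.mem_closedBall, not_le] at hx'; exact hx'.le)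
    have h1 : ψ 0 = 1 := ψ.one_of_mem_closedBall (by simp [ψ.rIn_pos.le])
    have := hx _ hL
    simp only [h0, h1, smul_eq_mul, mul_zero, mul_one, zero_sub, abs_neg, abs_inv,
      abs_of_pos hM0] at this
    rw [inv_le_inv₀ hM0 (by positivity)] at this
    linarith
  rcases le_or_gt r 0 with hr | hr
  · refine (isCompact_closedBall (0 : Fin n → ℝ) ψ.rOut).of_isClosed_subset (isClosed_dualBall r)
      fun x hx => hsmall x (dualBall_mono (hr.trans (by positivity)) hx)
  · have hl : 0 < (2 * M * r)⁻¹ := by positivity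
    have himg : IsCompact (weightDilation G.weight ((2 * M * r)⁻¹)⁻¹ ''
        Metric.closedBall (0 : Fin n → ℝ) ψ.rOut) :=
      (isCompact_closedBall _ _).image (contDiff_weightDilation _ _).continuous
    refine himg.of_isClosed_subset (isClosed_dualBall r) fun x hx => ?_
    refine ⟨weightDilation G.weight (2 * M * r)⁻¹ x, hsmall _ ?_, ?_⟩
    · have := weightDilation_mem_dualBall hl hx
      convert this using 2
      field_simp
    · rw [weightDilation_mul_mul, inv_mul_cancel₀ hl.ne', weightDilation_one]

end CarnotGroup

/-! ### The multiplication in graded coordinates, up to its first bracket term. -/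

/-- The component of `x` in the layer `V_r`. -/
def layerPart {n : ℕ} (weight : Fin n → ℕ) (r : ℕ) (x : Fin n → ℝ) : Fin n → ℝ :=
  fun l => if weight l = r then x l else 0

/-- The dilation divided by `lam ^ r`, for vectors without components of weight below `r`. -/
def shiftedDilation {n : ℕ} (weight : Fin n → ℕ) (r : ℕ) (x : Fin n → ℝ) (lam : ℝ) : Fin n → ℝ :=
  fun l => lam ^ (weight l - r) * x l

/-- All components of weight below `r` vanish. -/
def VanishesBelow {n : ℕ} (weight : Fin n → ℕ) (r : ℕ) (x : Fin n → ℝ) : Prop :=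
  ∀ l, weight l < r → x l = 0

section Coordinates

variable {n : ℕ} {weight : Fin n → ℕ} {r : ℕ} {x y : Fin n → ℝ}

theorem VanishesBelow.weightDilation_eq (hx : VanishesBelow weight r x) (lam : ℝ) :
    weightDilation weight lam x = lam ^ r • shiftedDilation weight r x lam := by
  ext l
  simp only [weightDilation, shiftedDilation, Pi.smul_apply, smul_eq_mul]
  rcases lt_or_ge (weight l) r with h | h
  · simp [hx l h]
  · rw [← mul_assoc, ← pow_add, Nat.add_sub_cancel' h]

theorem VanishesBelow.shiftedDilation_zero (hx : VanishesBelow weight r x) :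
    shiftedDilation weight r x 0 = layerPart weight r x := by
  ext l
  simp only [shiftedDilation, layerPart]
  rcases lt_trichotomy (weight l) r with h | h | h
  · simp [hx l h]
  · simp [h]
  · simp [h.ne', zero_pow (Nat.sub_pos_of_lt h).ne']

theorem VanishesBelow.hasDerivAt_shiftedDilation (hx : VanishesBelow weight r x) :
    HasDerivAt (shiftedDilation weight r x) (layerPart weight (r + 1) x) 0 := by
  rw [hasDerivAt_pi]
  intro l
  simp only [shiftedDilation, layerPart]
  have h := (hasDerivAt_pow (weight l - r) (0 : ℝ)).mul_const (x l)
  refine h.congr_deriv ?_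
  rcases lt_trichotomy (weight l) (r + 1) with h | h | h
  · rw [if_neg h.ne]
    rcases (Nat.lt_succ_iff.1 h).lt_or_eq with h | h
    · simp [hx l h]
    · simp [h]
  · simp [h]
  · have h1 : weight l - r - 1 ≠ 0 := by omega
    simp [h.ne', zero_pow h1]

theorem continuous_shiftedDilation (weight : Fin n → ℕ) (r : ℕ) (x : Fin n → ℝ) :
    Continuous (shiftedDilation weight r x) := by
  unfold shiftedDilation; fun_prop

theorem vanishesBelow_zero_weight (x : Fin n → ℝ) : VanishesBelow weight 0 x := fun _ h => by omega

theorem vanishesBelow_zero : VanishesBelow weight r 0 := fun _ _ => rfl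

theorem VanishesBelow.mono {s : ℕ} (hx : VanishesBelow weight r x) (h : s ≤ r) :
    VanishesBelow weight s x := fun l hl => hx l (hl.trans_le h)

theorem layerPart_apply_of_eq {k : Fin n} (h : weight k = r) : layerPart weight r x k = x k := by
  simp [layerPart, h]

theorem layerPart_smul (c : ℝ) : layerPart weight r (c • x) = c • layerPart weight r x := by
  ext l; simp [layerPart]

theorem layerPart_zero : layerPart weight r (0 : Fin n → ℝ) = 0 := by
  ext l; simp [layerPart]

theorem shiftedDilation_zero_weight (x : Fin n → ℝ) (lam : ℝ) :
    shiftedDilation weight 0 x lam = weightDilation weight lam x := by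
  ext l; simp [shiftedDilation, weightDilation]

theorem layerPart_eq_zero_of_weight_pos (hw : ∀ i, 1 ≤ weight i) (x : Fin n → ℝ) :
    layerPart weight 0 x = 0 := by
  ext l; simp [layerPart, Nat.one_le_iff_ne_zero.1 (hw l)]

end Coordinates

namespace LieGroupLaw

variable {n : ℕ} (G : LieGroupLaw n)

/-- The derivative of the group multiplication. -/
def mulDeriv (z : (Fin n → ℝ) × (Fin n → ℝ)) :
    (Fin n → ℝ) × (Fin n → ℝ) →L[ℝ] (Fin n → ℝ) :=
  fderiv ℝ (fun z : (Fin n → ℝ) × (Fin n → ℝ) => G.mul z.1 z.2) z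

theorem contDiff_mulDeriv : ContDiff ℝ ∞ G.mulDeriv := G.contDiff_mul.fderiv_right (by simp)

theorem mulDeriv_mk_zero_right (x y : Fin n → ℝ) : G.mulDeriv (0, x) (0, y) = y := by
  have h := (G.hasFDerivAt_mul (0, x)).comp x
    ((hasFDerivAt_const 0 x).prodMk (hasFDerivAt_id x))
  have h2 : HasFDerivAt (fun q => G.mul 0 q) _ x := h
  simp only [G.zero_mul] at h2
  simpa [mulDeriv] using (DFunLike.congr_fun ((hasFDerivAt_id x).unique h2) y).symm

theorem mulDeriv_mk_zero_left (x y : Fin n → ℝ) : G.mulDeriv (x, 0) (y, 0) = y := by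
  have h0 : HasFDerivAt (𝕜 := ℝ) (fun p : Fin n → ℝ => (p, (0 : Fin n → ℝ))) _ x :=
    (hasFDerivAt_id x).prodMk (hasFDerivAt_const (0 : Fin n → ℝ) x)
  have h := HasFDerivAt.comp (f := fun p : Fin n → ℝ => (p, (0 : Fin n → ℝ)))
    x (G.hasFDerivAt_mul (x, 0)) h0
  have h2 : HasFDerivAt (fun q => G.mul q 0) _ x := h
  simp only [G.mul_zero] at h2
  simpa [mulDeriv] using (DFunLike.congr_fun ((hasFDerivAt_id x).unique h2) y).symm

theorem mulDeriv_zero (q : (Fin n → ℝ) × (Fin n → ℝ)) : G.mulDeriv 0 q = q.1 + q.2 := by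
  have : q = (q.1, 0) + (0, q.2) := by simp
  conv_lhs => rw [this, map_add]
  rw [← Prod.mk_zero_zero, mulDeriv_mk_zero_left, mulDeriv_mk_zero_right]

theorem fderiv_mulDeriv_symm (u v : (Fin n → ℝ) × (Fin n → ℝ)) :
    fderiv ℝ G.mulDeriv 0 u v = fderiv ℝ G.mulDeriv 0 v u :=
  (G.contDiff_mul.contDiffAt (x := 0)).isSymmSndFDerivAt
    (by
      rw [minSmoothness_of_isRCLikeNormedField]
      exact WithTop.coe_le_coe.2 (le_top : (2 : ℕ∞) ≤ ⊤)) u v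

theorem leftInvariantField_at_zero (x : Fin n → ℝ) : G.leftInvariantField x 0 = x := by
  rw [leftInvariantField_eq]; exact G.mulDeriv_mk_zero_right 0 x

theorem fderiv_leftInvariantField (x y : Fin n → ℝ) :
    fderiv ℝ (G.leftInvariantField y) 0 x = fderiv ℝ G.mulDeriv 0 (x, 0) (0, y) := by
  have h1 : HasFDerivAt G.mulDeriv (fderiv ℝ G.mulDeriv 0) ((0 : Fin n → ℝ), (0 : Fin n → ℝ)) :=
    (G.contDiff_mulDeriv.differentiable (by simp) 0).hasFDerivAt
  have h0 : HasFDerivAt (𝕜 := ℝ) (fun p : Fin n → ℝ => (p, (0 : Fin n → ℝ))) _ 0 :=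
    (hasFDerivAt_id (0 : Fin n → ℝ)).prodMk (hasFDerivAt_const (0 : Fin n → ℝ) (0 : Fin n → ℝ))
  have h2 := (HasFDerivAt.comp (f := fun p : Fin n → ℝ => (p, (0 : Fin n → ℝ)))
    0 h1 h0).clm_apply
    (hasFDerivAt_const ((0 : Fin n → ℝ), y) 0)
  have h3 : HasFDerivAt (G.leftInvariantField y) _ 0 :=
    h2.congr_of_eventuallyEq (.of_forall fun p => G.leftInvariantField_eq y p)
  rw [h3.fderiv]
  simp

theorem bracket_eq (x y : Fin n → ℝ) : G.bracket x y =
    fderiv ℝ G.mulDeriv 0 (x, 0) (0, y) - fderiv ℝ G.mulDeriv 0 (y, 0) (0, x) := by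
  simp [bracket, VectorField.lieBracket, leftInvariantField_at_zero, fderiv_leftInvariantField]

theorem hasDerivAt_mul_line (z q : (Fin n → ℝ) × (Fin n → ℝ)) (t : ℝ) (k : Fin n) :
    HasDerivAt (fun t : ℝ => G.mul (z.1 + t • q.1) (z.2 + t • q.2) k)
      (G.mulDeriv (z + t • q) q k) t := by
  have h1 : HasDerivAt (fun t : ℝ => z + t • q) q t := by
    simpa using ((hasDerivAt_id t).smul_const q).const_add z
  have h2 := (G.hasFDerivAt_mul (z + t • q)).comp_hasDerivAt t h1
  exact (hasDerivAt_pi.1 h2) k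

end LieGroupLaw

namespace CarnotGroup

variable {n : ℕ} (G : CarnotGroup n)

theorem weightDilation_mulDeriv {lam : ℝ} (hl : 0 < lam) (z q : (Fin n → ℝ) × (Fin n → ℝ)) :
    weightDilation G.weight lam (G.mulDeriv z q) =
      G.mulDeriv (weightDilation G.weight lam z.1, weightDilation G.weight lam z.2)
        (weightDilation G.weight lam q.1, weightDilation G.weight lam q.2) := by
  have h1 := (G.hasFDerivAt_weightDilation lam (G.mul z.1 z.2)).comp z (G.hasFDerivAt_mul z)
  have hd : HasFDerivAt (fun z : (Fin n → ℝ) × (Fin n → ℝ) =>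
      (weightDilation G.weight lam z.1, weightDilation G.weight lam z.2)) _ z :=
    ((G.hasFDerivAt_weightDilation lam z.1).comp z hasFDerivAt_fst).prodMk
      ((G.hasFDerivAt_weightDilation lam z.2).comp z hasFDerivAt_snd)
  have h2 := (G.hasFDerivAt_mul
    (weightDilation G.weight lam z.1, weightDilation G.weight lam z.2)).comp z hd
  have h3 : (weightDilation G.weight lam ∘ fun z : (Fin n → ℝ) × (Fin n → ℝ) => G.mul z.1 z.2) =
      (fun z : (Fin n → ℝ) × (Fin n → ℝ) => G.mul z.1 z.2) ∘ (fun z =>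
        (weightDilation G.weight lam z.1, weightDilation G.weight lam z.2)) := by
    ext1 s; simp [G.dilation_mul lam hl]
  rw [h3] at h1
  have h4 := DFunLike.congr_fun (h1.unique h2) q
  simpa [coe_weightDilationCLM, LieGroupLaw.mulDeriv] using h4

/-- Homogeneity of the derivative of the multiplication, with the weight of `q` divided out. -/
theorem pow_mul_mulDeriv_apply {r s : ℕ} {k : Fin n} (hk : G.weight k = r + s) {lam : ℝ}
    (hl : 0 < lam) (z : (Fin n → ℝ) × (Fin n → ℝ)) {q : (Fin n → ℝ) × (Fin n → ℝ)}
    (h1 : VanishesBelow G.weight r q.1) (h2 : VanishesBelow G.weight r q.2) :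
    lam ^ s * G.mulDeriv z q k =
      G.mulDeriv (shiftedDilation G.weight 0 z.1 lam, shiftedDilation G.weight 0 z.2 lam)
        (shiftedDilation G.weight r q.1 lam, shiftedDilation G.weight r q.2 lam) k := by
  have h := congr_fun (G.weightDilation_mulDeriv hl z q) k
  rw [h1.weightDilation_eq, h2.weightDilation_eq, ← Prod.smul_mk, map_smul, Pi.smul_apply,
    smul_eq_mul, weightDilation, hk, pow_add, mul_assoc] at h
  simpa only [shiftedDilation_zero_weight] using mul_left_cancel₀ (pow_pos hl r).ne' h

/-- By homogeneity the left side does not change when `z` is dilated towards the origin, where the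
derivative of the multiplication is addition. Components of `q` of weight above that of `k`
disappear in the limit. -/
theorem mulDeriv_apply_of_vanishesBelow {k : Fin n} (z : (Fin n → ℝ) × (Fin n → ℝ))
    {q : (Fin n → ℝ) × (Fin n → ℝ)} (h1 : VanishesBelow G.weight (G.weight k) q.1)
    (h2 : VanishesBelow G.weight (G.weight k) q.2) : G.mulDeriv z q k = q.1 k + q.2 k := by
  set F : ℝ → ℝ := fun lam =>
    G.mulDeriv (shiftedDilation G.weight 0 z.1 lam, shiftedDilation G.weight 0 z.2 lam)
      (shiftedDilation G.weight (G.weight k) q.1 lam,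
        shiftedDilation G.weight (G.weight k) q.2 lam) k with hF
  have hFc : Continuous F := by
    have h := (G.contDiff_mulDeriv.continuous.comp
      ((continuous_shiftedDilation G.weight 0 z.1).prodMk
        (continuous_shiftedDilation G.weight 0 z.2))).clm_apply
      ((continuous_shiftedDilation G.weight (G.weight k) q.1).prodMk
        (continuous_shiftedDilation G.weight (G.weight k) q.2))
    exact (continuous_apply k).comp h
  have hF0 : F 0 = q.1 k + q.2 k := by
    simp only [hF]
    rw [(vanishesBelow_zero_weight z.1).shiftedDilation_zero,
      (vanishesBelow_zero_weight z.2).shiftedDilation_zero,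
      layerPart_eq_zero_of_weight_pos G.weight_pos, layerPart_eq_zero_of_weight_pos G.weight_pos,
      h1.shiftedDilation_zero, h2.shiftedDilation_zero, Prod.mk_zero_zero, G.mulDeriv_zero]
    simp [layerPart]
  have hFp : ∀ lam ∈ Set.Ioi (0 : ℝ), F lam = G.mulDeriv z q k := fun lam hl => by
    simpa using (G.pow_mul_mulDeriv_apply (r := G.weight k) (s := 0) rfl hl z h1 h2).symm
  have t1 : Tendsto F (𝓝[>] 0) (𝓝 (F 0)) := hFc.continuousAt.mono_left nhdsWithin_le_nhds
  have t2 : Tendsto F (𝓝[>] 0) (𝓝 (G.mulDeriv z q k)) :=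
    tendsto_const_nhds.congr' (eventually_nhdsWithin_of_forall fun l hl => (hFp l hl).symm)
  rw [← hF0]
  exact tendsto_nhds_unique t2 t1

/-- One order further: homogeneity reads `lam * G.mulDeriv z q k = F lam`, so the quantity sought is
`F'(0)`, and the chain rule brings in the second derivative of the multiplication at the origin. -/
theorem mulDeriv_apply_of_weight_eq_succ {r : ℕ} {k : Fin n} (hk : G.weight k = r + 1)
    (z : (Fin n → ℝ) × (Fin n → ℝ)) {q : (Fin n → ℝ) × (Fin n → ℝ)}
    (h1 : VanishesBelow G.weight r q.1) (h2 : VanishesBelow G.weight r q.2) :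
    G.mulDeriv z q k = fderiv ℝ G.mulDeriv 0
      (layerPart G.weight 1 z.1, layerPart G.weight 1 z.2)
      (layerPart G.weight r q.1, layerPart G.weight r q.2) k + (q.1 k + q.2 k) := by
  set F : ℝ → ℝ := fun lam =>
    G.mulDeriv (shiftedDilation G.weight 0 z.1 lam, shiftedDilation G.weight 0 z.2 lam)
      (shiftedDilation G.weight r q.1 lam, shiftedDilation G.weight r q.2 lam) k with hF
  have e0 : (shiftedDilation G.weight 0 z.1 0, shiftedDilation G.weight 0 z.2 0) = 0 := by
    rw [(vanishesBelow_zero_weight z.1).shiftedDilation_zero,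
      (vanishesBelow_zero_weight z.2).shiftedDilation_zero,
      layerPart_eq_zero_of_weight_pos G.weight_pos, layerPart_eq_zero_of_weight_pos G.weight_pos,
      Prod.mk_zero_zero]
  have hD : HasFDerivAt G.mulDeriv (fderiv ℝ G.mulDeriv 0)
      (shiftedDilation G.weight 0 z.1 0, shiftedDilation G.weight 0 z.2 0) := by
    rw [e0]; exact (G.contDiff_mulDeriv.differentiable (by simp) 0).hasFDerivAt
  have d1 := hD.comp_hasDerivAt (0 : ℝ)
    ((vanishesBelow_zero_weight z.1).hasDerivAt_shiftedDilation.prodMk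
      (vanishesBelow_zero_weight z.2).hasDerivAt_shiftedDilation)
  have d2 := d1.clm_apply (h1.hasDerivAt_shiftedDilation.prodMk h2.hasDerivAt_shiftedDilation)
  have d3 := (hasDerivAt_pi.1 d2) k
  simp only [Function.comp_apply, e0, G.mulDeriv_zero, h1.shiftedDilation_zero,
    h2.shiftedDilation_zero, Pi.add_apply, layerPart_apply_of_eq hk, zero_add] at d3
  have d4 : HasDerivWithinAt F _ (Set.Ici 0) 0 := d3.hasDerivWithinAt
  have hF0 : F 0 = 0 := by
    simp only [hF, e0, G.mulDeriv_zero, h1.shiftedDilation_zero, h2.shiftedDilation_zero,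
      Pi.add_apply]
    simp [layerPart, hk]
  have d5 : HasDerivWithinAt F (G.mulDeriv z q k) (Set.Ici 0) 0 := by
    -- Homogeneity is known for positive `lam` only, so the derivatives are compared from the right.
    have : HasDerivWithinAt (fun t : ℝ => t * G.mulDeriv z q k) (G.mulDeriv z q k)
        (Set.Ici 0) 0 := by
      simpa using ((hasDerivAt_id (0 : ℝ)).mul_const (G.mulDeriv z q k)).hasDerivWithinAt
    refine this.congr (fun t ht => ?_) (by simp [hF0])
    rcases (Set.mem_Ici.1 ht).eq_or_lt with h | h
    · simp [← h, hF0]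
    · simpa using (G.pow_mul_mulDeriv_apply hk h z h1 h2).symm
  exact (uniqueDiffWithinAt_Ici 0).eq_deriv _ d5 d4

/-- Coordinates of weight `r` of a product depend on the coordinates of weight at least `r` of the
factors only through addition. -/
theorem mul_apply_sub_mul_apply {k : Fin n} {x x' y y' : Fin n → ℝ}
    (hx : VanishesBelow G.weight (G.weight k) (x - x'))
    (hy : VanishesBelow G.weight (G.weight k) (y - y')) :
    G.mul x y k - G.mul x' y' k = (x k - x' k) + (y k - y' k) := by
  -- Along the segment the `k`-th coordinate has constant derivative, so `g` is constant.
  set g : ℝ → ℝ := fun t => G.mul (x' + t • (x - x')) (y' + t • (y - y')) k -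
    t * ((x k - x' k) + (y k - y' k)) with hg
  have hd : ∀ t, HasDerivAt g 0 t := fun t => by
    have h := (G.hasDerivAt_mul_line (x', y') (x - x', y - y') t k).sub
      ((hasDerivAt_id t).mul_const ((x k - x' k) + (y k - y' k)))
    rw [G.mulDeriv_apply_of_vanishesBelow _ hx hy] at h
    exact h.congr_deriv (by simp)
  have h := is_const_of_deriv_eq_zero (fun t => (hd t).differentiableAt) (fun t => (hd t).deriv) 1 0
  simp [hg] at h
  linarith

theorem mul_apply_of_vanishesBelow_right {k : Fin n} (x : Fin n → ℝ) {y : Fin n → ℝ}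
    (hy : VanishesBelow G.weight (G.weight k) y) : G.mul x y k = x k + y k := by
  have := G.mul_apply_sub_mul_apply (x := x) (x' := x) (y := y) (y' := 0)
    (by rw [sub_self]; exact vanishesBelow_zero) (by simpa using hy)
  simp [G.mul_zero] at this
  linarith

theorem mul_apply_of_vanishesBelow_left {k : Fin n} {x : Fin n → ℝ} (y : Fin n → ℝ)
    (hx : VanishesBelow G.weight (G.weight k) x) : G.mul x y k = x k + y k := by
  have := G.mul_apply_sub_mul_apply (x := x) (x' := 0) (y := y) (y' := y)
    (by simpa using hx) (by rw [sub_self]; exact vanishesBelow_zero)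
  simp [G.zero_mul] at this
  linarith

theorem inv_apply_of_vanishesBelow {k : Fin n} {x : Fin n → ℝ}
    (hx : VanishesBelow G.weight (G.weight k) x) : G.inv x k = - x k := by
  have := G.mul_apply_of_vanishesBelow_right (G.inv x) hx
  rw [G.inv_mul] at this
  simp at this
  linarith

theorem vanishesBelow_mul {r : ℕ} {x y : Fin n → ℝ} (hx : VanishesBelow G.weight r x)
    (hy : VanishesBelow G.weight r y) : VanishesBelow G.weight r (G.mul x y) := fun k hk => by
  rw [G.mul_apply_of_vanishesBelow_left y (hx.mono hk.le), hx k hk, hy k hk, add_zero]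

theorem vanishesBelow_inv {r : ℕ} {x : Fin n → ℝ} (hx : VanishesBelow G.weight r x) :
    VanishesBelow G.weight r (G.inv x) := fun k hk => by
  rw [G.inv_apply_of_vanishesBelow (hx.mono hk.le), hx k hk, neg_zero]

/-- Replace `y` by `t • y` and differentiate in `t`. The second derivatives within a single factor
contribute nothing (`h0`, `h0'`), because multiplication by the identity is linear. The two mixed
ones form the bracket. -/
theorem mul_apply_sub_mul_apply_swap {r : ℕ} {k : Fin n} (hk : G.weight k = r + 1)
    (x : Fin n → ℝ) {y : Fin n → ℝ} (hy : VanishesBelow G.weight r y) :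
    G.mul x y k - G.mul y x k = G.bracket (layerPart G.weight 1 x) (layerPart G.weight r y) k := by
  have h0 : ∀ a : Fin n → ℝ, fderiv ℝ G.mulDeriv 0
      (0, layerPart G.weight 1 a) (0, layerPart G.weight r y) k = 0 := fun a => by
    have := G.mulDeriv_apply_of_weight_eq_succ hk (0, a) (q := (0, y)) vanishesBelow_zero hy
    rw [G.mulDeriv_mk_zero_right] at this
    simpa [layerPart_zero] using this
  have h0' : ∀ a : Fin n → ℝ, fderiv ℝ G.mulDeriv 0
      (layerPart G.weight 1 a, 0) (layerPart G.weight r y, 0) k = 0 := fun a => by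
    have := G.mulDeriv_apply_of_weight_eq_succ hk (a, 0) (q := (y, 0)) hy vanishesBelow_zero
    rw [G.mulDeriv_mk_zero_left] at this
    simpa [layerPart_zero] using this
  have hsplit : ∀ (a b : Fin n → ℝ) q, fderiv ℝ G.mulDeriv 0 (a, b) q k =
      fderiv ℝ G.mulDeriv 0 (a, 0) q k + fderiv ℝ G.mulDeriv 0 (0, b) q k := fun a b q => by
    rw [show (a, b) = (a, 0) + (0, b) by simp, map_add]; rfl
  set B := G.bracket (layerPart G.weight 1 x) (layerPart G.weight r y) k with hB
  set g : ℝ → ℝ := fun t => G.mul (x + t • 0) (0 + t • y) k - G.mul (0 + t • y) (x + t • 0) k -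
    t * B with hg
  have hd : ∀ t, HasDerivAt g 0 t := fun t => by
    have h := ((G.hasDerivAt_mul_line (x, 0) (0, y) t k).sub
      (G.hasDerivAt_mul_line (0, x) (y, 0) t k)).sub ((hasDerivAt_id t).mul_const B)
    rw [G.mulDeriv_apply_of_weight_eq_succ hk _ vanishesBelow_zero hy,
      G.mulDeriv_apply_of_weight_eq_succ hk _ hy vanishesBelow_zero] at h
    refine h.congr_deriv ?_
    simp only [Prod.fst_add, Prod.snd_add, Prod.smul_fst, Prod.smul_snd, smul_zero, zero_add,
      add_zero, layerPart_zero]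
    rw [hsplit, hsplit (layerPart G.weight 1 (t • y)), h0, h0', hB, G.bracket_eq,
      G.fderiv_mulDeriv_symm (0, layerPart G.weight 1 x)]
    simp
  have h := is_const_of_deriv_eq_zero (fun t => (hd t).differentiableAt) (fun t => (hd t).deriv) 1 0
  simp [hg, G.zero_mul, G.mul_zero] at h
  linarith

/-- `xy` and `yx` agree below weight `r + 1`. Comparing `(xy)(yx)⁻¹` with `(yx)(yx)⁻¹ = 0` therefore
turns the group commutator into the difference `xy - yx` up to that weight. -/
theorem commutator_apply {r : ℕ} (x : Fin n → ℝ) {y : Fin n → ℝ}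
    (hy : VanishesBelow G.weight r y) :
    VanishesBelow G.weight (r + 1) (G.mul (G.mul x y) (G.inv (G.mul y x))) ∧
    ∀ k, G.weight k = r + 1 → G.mul (G.mul x y) (G.inv (G.mul y x)) k =
      G.bracket (layerPart G.weight 1 x) (layerPart G.weight r y) k := by
  have hlow : VanishesBelow G.weight (r + 1) (G.mul x y - G.mul y x) := fun k hk => by
    have hy' := hy.mono (Nat.lt_succ_iff.1 hk)
    rw [Pi.sub_apply, G.mul_apply_of_vanishesBelow_right x hy',
      G.mul_apply_of_vanishesBelow_left x hy']
    ring
  have key : ∀ k, G.weight k ≤ r + 1 →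
      G.mul (G.mul x y) (G.inv (G.mul y x)) k = G.mul x y k - G.mul y x k := fun k hk => by
    have := G.mul_apply_sub_mul_apply (y := G.inv (G.mul y x)) (y' := G.inv (G.mul y x))
      (hlow.mono hk) (by rw [sub_self]; exact vanishesBelow_zero)
    rw [G.mul_inv] at this
    simpa using this
  refine ⟨fun k hk => ?_, fun k hk => ?_⟩
  · rw [key k hk.le]; exact hlow k hk
  · rw [key k hk.le, G.mul_apply_sub_mul_apply_swap hk x hy]

end CarnotGroup

/-! ### Bracket generation: every point is at finite dual distance. -/

namespace CarnotGroup

variable {n : ℕ} (G : CarnotGroup n)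

/-- The point is reached by flowing along `X_i` for time `c`. A test function changes at rate `X_i
f`, hence by at most `c`, and the weight-one coordinates of `X_i` are constant. -/
theorem exists_mem_dualBall_layer_one (i : G.HorizontalIndex) :
    ∃ c > 0, ∃ x ∈ G.dualBall c,
      ∀ k, G.weight k = 1 → x k = c * (Pi.single i.1 1 : Fin n → ℝ) k := by
  set e : Fin n → ℝ := Pi.single i.1 1 with he
  obtain ⟨γ, hγ0, ε, hε, hγ⟩ :=
    ContDiffAt.exists_forall_mem_closedBall_exists_eq_forall_mem_Ioo_hasDerivAt₀
    (f := G.leftInvariantField e) (((G.contDiff_leftInvariantField e).of_le (m := 1)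
      (by exact_mod_cast le_top)).contDiffAt (x := 0)) 0
  simp only [zero_sub, zero_add] at hγ
  have hsub : ∀ t ∈ Set.Icc 0 (ε / 2), t ∈ Set.Ioo (-ε) ε := fun t ht =>
    ⟨by linarith [ht.1], by linarith [ht.2]⟩
  have hmem : ε / 2 ∈ Set.Icc 0 (ε / 2) := ⟨by positivity, le_rfl⟩
  refine ⟨ε / 2, by positivity, γ (ε / 2), fun f hf => ?_, fun k hk => ?_⟩
  · have hd : ∀ t ∈ Set.Icc 0 (ε / 2), HasDerivWithinAt (f ∘ γ) (G.horizontalDeriv i f (γ t))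
        (Set.Icc 0 (ε / 2)) t := fun t ht =>
      (((hf.1.differentiable (by simp)) (γ t)).hasFDerivAt.comp_hasDerivAt t
        (hγ t (hsub t ht))).hasDerivWithinAt
    have := norm_image_sub_le_of_norm_deriv_le_segment' hd (C := 1)
      (fun t _ => hf.2 i (γ t)) (ε / 2) hmem
    simpa [hγ0] using this
  · have hcoord : ∀ p, G.leftInvariantField e p k = e k := fun p => by
      rw [G.leftInvariantField_eq]
      have := G.mulDeriv_apply_of_vanishesBelow (k := k) (p, 0) (q := (0, e)) vanishesBelow_zero
        (fun l hl => by have := G.weight_pos l; omega)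
      simpa [LieGroupLaw.mulDeriv] using this
    have hd : ∀ t ∈ Set.Icc 0 (ε / 2),
        HasDerivWithinAt (fun t => γ t k - t * e k) 0 (Set.Icc 0 (ε / 2)) t := fun t ht => by
      have h := (hasDerivAt_pi.1 (hγ t (hsub t ht)) k).sub ((hasDerivAt_id t).mul_const (e k))
      exact (h.congr_deriv (by simp [hcoord])).hasDerivWithinAt
    have := norm_image_sub_le_of_norm_deriv_le_segment' hd (C := 0) (by simp) (ε / 2) hmem
    simp only [hγ0, zero_mul, sub_zero, Pi.zero_apply] at this
    exact sub_eq_zero.1 (norm_le_zero_iff.1 this)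

/-- The vectors whose component in `V_r` is the leading part of a point at finite distance from the
identity. -/
def leadingPartSubmodule (r : ℕ) (hr : r ≠ 0) : Submodule ℝ (Fin n → ℝ) where
  carrier := {z | ∃ M, ∃ x ∈ G.dualBall M, VanishesBelow G.weight r x ∧
    ∀ k, G.weight k = r → x k = z k}
  zero_mem' := ⟨0, 0, zero_mem_dualBall le_rfl, vanishesBelow_zero, fun _ _ => rfl⟩
  add_mem' := by
    rintro z z' ⟨M, x, hx, hxr, hxz⟩ ⟨M', x', hx', hxr', hxz'⟩
    refine ⟨M + M', G.mul x x', mul_mem_dualBall hx hx', G.vanishesBelow_mul hxr hxr',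
      fun k hk => ?_⟩
    rw [G.mul_apply_of_vanishesBelow_left x' (hxr.mono hk.le), hxz k hk, hxz' k hk, Pi.add_apply]
  smul_mem' := by
    have hpos : ∀ c : ℝ, 0 < c → ∀ z : Fin n → ℝ, (∃ M, ∃ x ∈ G.dualBall M,
        VanishesBelow G.weight r x ∧ ∀ k, G.weight k = r → x k = z k) → ∃ M, ∃ x ∈ G.dualBall M,
        VanishesBelow G.weight r x ∧ ∀ k, G.weight k = r → x k = (c • z) k := by
      rintro c hc z ⟨M, x, hx, hxr, hxz⟩
      -- Dilation by `c ^ (1/r)` multiplies the layer `V_r` by `c`; negative scalars are handled by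
      -- group inversion.
      have hl : 0 < c ^ ((r : ℝ)⁻¹) := Real.rpow_pos_of_pos hc _
      refine ⟨_, weightDilation G.weight (c ^ ((r : ℝ)⁻¹)) x, weightDilation_mem_dualBall hl hx,
        fun l hlr => by simp [weightDilation, hxr l hlr], fun k hk => ?_⟩
      simp [weightDilation, hk, Real.rpow_inv_natCast_pow hc.le hr, hxz k hk]
    intro c z hz
    rcases lt_trichotomy c 0 with hc | hc | hc
    · obtain ⟨M, x, hx, hxr, hxz⟩ := hpos (-c) (neg_pos.2 hc) z hz
      refine ⟨M, G.inv x, inv_mem_dualBall hx, G.vanishesBelow_inv hxr, fun k hk => ?_⟩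
      rw [G.inv_apply_of_vanishesBelow (hxr.mono hk.le), hxz k hk]
      simp
    · exact ⟨0, 0, zero_mem_dualBall le_rfl, vanishesBelow_zero, fun _ _ => by simp [hc]⟩
    · exact hpos c hc z hz

theorem layerPart_of_mem_weightLayer {weight : Fin n → ℕ} {r : ℕ} {x : Fin n → ℝ}
    (hx : x ∈ weightLayer weight r) : layerPart weight r x = x := by
  induction hx using Submodule.span_induction with
  | mem x h =>
    obtain ⟨i, hi, rfl⟩ := h
    ext l
    by_cases hl : l = i
    · subst hl; simp [layerPart, hi]
    · simp [layerPart, hl]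
  | zero => exact layerPart_zero
  | add x y _ _ hx hy =>
    rw [← hx, ← hy]; ext l; simp only [layerPart, Pi.add_apply]; split_ifs <;> simp
  | smul c x _ hx => rw [layerPart_smul, hx]

theorem weightLayer_one_le_leadingPartSubmodule :
    weightLayer G.weight 1 ≤ G.leadingPartSubmodule 1 one_ne_zero := by
  refine Submodule.span_le.2 ?_
  rintro _ ⟨i, hi, rfl⟩
  obtain ⟨c, hc, x, hx, hxk⟩ := G.exists_mem_dualBall_layer_one ⟨i, hi⟩
  have hm : c • (Pi.single i 1 : Fin n → ℝ) ∈ G.leadingPartSubmodule 1 one_ne_zero :=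
    ⟨c, x, hx, fun l hl => by have := G.weight_pos l; omega, fun k hk => hxk k hk⟩
  simpa [smul_smul, hc.ne'] using Submodule.smul_mem _ c⁻¹ hm

/-- Since leading parts form a subspace, it suffices to reach the spanning brackets `[V_1, V_r]`,
and these are leading parts of group commutators. -/
theorem weightLayer_le_leadingPartSubmodule (r : ℕ) :
    weightLayer G.weight (r + 1) ≤ G.leadingPartSubmodule (r + 1) (Nat.succ_ne_zero r) := by
  induction r with
  | zero => exact G.weightLayer_one_le_leadingPartSubmodule
  | succ r ih =>
    rw [G.stratified (r + 1) (by omega)]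
    refine Submodule.span_le.2 ?_
    rintro _ ⟨X, hX, Y, hY, rfl⟩
    obtain ⟨M, x, hx, hxr, hxX⟩ := G.weightLayer_one_le_leadingPartSubmodule hX
    obtain ⟨M', y, hy, hyr, hyY⟩ := ih hY
    have eX : layerPart G.weight 1 x = X := by
      rw [← layerPart_of_mem_weightLayer hX]
      ext l; simp only [layerPart]; split_ifs with h
      · exact hxX l h
      · rfl
    have eY : layerPart G.weight (r + 1) y = Y := by
      rw [← layerPart_of_mem_weightLayer hY]
      ext l; simp only [layerPart]; split_ifs with h
      · exact hyY l h
      · rfl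
    obtain ⟨hc1, hc2⟩ := G.commutator_apply x hyr
    rw [eX, eY] at hc2
    exact ⟨_, _, mul_mem_dualBall (mul_mem_dualBall hx hy)
      (inv_mem_dualBall (mul_mem_dualBall hy hx)), hc1, hc2⟩

theorem layerPart_mem_weightLayer (r : ℕ) (x : Fin n → ℝ) :
    layerPart G.weight r x ∈ weightLayer G.weight r := by
  have : layerPart G.weight r x =
      ∑ l, layerPart G.weight r x l • (Pi.single l 1 : Fin n → ℝ) := by
    ext k; simp [Finset.sum_apply, Pi.single_apply]
  rw [this]
  refine Submodule.sum_mem _ fun l _ => ?_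
  by_cases hl : G.weight l = r
  · exact Submodule.smul_mem _ _ (Submodule.subset_span ⟨l, hl, rfl⟩)
  · simp [layerPart, hl]

theorem exists_mem_dualBall (x : Fin n → ℝ) : ∃ M, x ∈ G.dualBall M := by
  obtain ⟨s, hs⟩ : ∃ s, ∀ k, G.weight k ≤ s :=
    ⟨∑ k, G.weight k, fun k => Finset.single_le_sum (fun _ _ => Nat.zero_le _) (Finset.mem_univ k)⟩
  -- Here `d` bounds the number of layers still to be cleared. Left multiplication by the inverse of
  -- a point `h` with the same leading part clears one layer.
  suffices h : ∀ d r, s + 1 ≤ r + 1 + d → ∀ x, VanishesBelow G.weight (r + 1) x →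
      ∃ M, x ∈ G.dualBall M by
    exact h s 0 (by omega) x fun l hl => by have := G.weight_pos l; omega
  intro d
  induction d with
  | zero =>
    intro r hr x hx
    have : x = 0 := funext fun l => hx l (by have := hs l; omega)
    exact ⟨0, this ▸ zero_mem_dualBall le_rfl⟩
  | succ d ih =>
    intro r hr x hx
    obtain ⟨M, h, hM, hv, hk⟩ :=
      G.weightLayer_le_leadingPartSubmodule r (G.layerPart_mem_weightLayer (r + 1) x)
    obtain ⟨M', hM'⟩ := ih (r + 1) (by omega) (G.mul (G.inv h) x) (fun l hl => by
      have hl' : G.weight l ≤ r + 1 := by omega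
      rw [G.mul_apply_of_vanishesBelow_right _ (hx.mono hl'),
        G.inv_apply_of_vanishesBelow (hv.mono hl')]
      rcases hl'.lt_or_eq with h1 | h1
      · rw [hv l h1, hx l h1]; simp
      · rw [hk l h1, layerPart_apply_of_eq h1]; simp)
    have := mul_mem_dualBall hM hM'
    rw [G.mul_inv_cancel_left] at this
    exact ⟨_, this⟩

/-- By Baire some ball of integer radius has an interior point. Translating it to the origin doubles
the radius at most, and a dilation then shrinks the ball to radius `r`. -/
theorem dualBall_mem_nhds {r : ℝ} (hr : 0 < r) : G.dualBall r ∈ 𝓝 (0 : Fin n → ℝ) := by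
  obtain ⟨N, y, hy⟩ := nonempty_interior_of_iUnion_of_closed
    (f := fun N : ℕ => G.dualBall (N : ℝ)) (fun N => isClosed_dualBall _) (by
      refine Set.eq_univ_of_forall fun x => Set.mem_iUnion.2 ?_
      obtain ⟨M, hM⟩ := G.exists_mem_dualBall x
      obtain ⟨N, hN⟩ := exists_nat_ge M
      exact ⟨N, dualBall_mono hN hM⟩)
  have h1 : G.mul y ⁻¹' interior (G.dualBall N) ∈ 𝓝 (0 : Fin n → ℝ) :=
    (isOpen_interior.preimage (G.continuous_mul_left y)).mem_nhds (by simpa [G.mul_zero] using hy)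
  have h2 : G.dualBall (2 * N + 1) ∈ 𝓝 (0 : Fin n → ℝ) := by
    refine mem_of_superset h1 fun x hx => ?_
    have := mul_mem_dualBall (inv_mem_dualBall (interior_subset hy)) (interior_subset hx)
    rw [G.inv_mul_cancel_left] at this
    exact dualBall_mono (by linarith) this
  have hl : 0 < (2 * (N : ℝ) + 1) / r := by positivity
  have h3 : weightDilation G.weight ((2 * (N : ℝ) + 1) / r) ⁻¹' G.dualBall (2 * N + 1) ∈
      𝓝 (0 : Fin n → ℝ) :=
    (contDiff_weightDilation G.weight _).continuous.continuousAt.preimage_mem_nhds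
      (by rwa [weightDilation_zero])
  refine mem_of_superset h3 fun x hx => (weightDilation_mem_dualBall_iff hl).1 ?_
  rwa [div_mul_cancel₀ _ hr.ne']

/-! ### Volume -/

theorem det_comp (A B : (Fin n → ℝ) →L[ℝ] (Fin n → ℝ)) : (A.comp B).det = A.det * B.det :=
  LinearMap.det_comp _ _

/-- The Jacobian is unchanged when `p` and `q` are dilated together; as the dilation factor tends to
0 it tends to its value at the origin, where `L_0 = id`. -/
theorem det_fderiv_mul_left (p q : Fin n → ℝ) : (fderiv ℝ (G.mul p) q).det = 1 := by
  set J : (Fin n → ℝ) × (Fin n → ℝ) → ℝ := fun z => (fderiv ℝ (G.mul z.1) z.2).det with hJ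
  have hJc : Continuous J := by
    have h1 : Continuous fun z : (Fin n → ℝ) × (Fin n → ℝ) => fderiv ℝ (G.mul z.1) z.2 := by
      have h : ContDiff ℝ ∞ (Function.uncurry fun z : (Fin n → ℝ) × (Fin n → ℝ) => G.mul z.1) :=
        G.contDiff_mul.comp ((contDiff_fst.comp contDiff_fst).prodMk contDiff_snd)
      exact (ContDiff.fderiv (n := 0) h contDiff_snd (by simp)).continuous
    exact ContinuousLinearMap.continuous_det.comp h1
  have hJ0 : J 0 = 1 := by
    have : G.mul 0 = id := funext G.zero_mul
    simp [hJ, this, ContinuousLinearMap.det]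
  have hinv : ∀ lam ∈ Set.Ioi (0 : ℝ),
      J (weightDilation G.weight lam p, weightDilation G.weight lam q) = J (p, q) := fun lam hl => by
    have h1 := (G.hasFDerivAt_weightDilation lam (G.mul p q)).comp q
      (G.differentiable_mul_left p q).hasFDerivAt
    have h2 := (G.differentiable_mul_left (weightDilation G.weight lam p)
      (weightDilation G.weight lam q)).hasFDerivAt.comp q (G.hasFDerivAt_weightDilation lam q)
    have h3 : weightDilation G.weight lam ∘ G.mul p =
        G.mul (weightDilation G.weight lam p) ∘ weightDilation G.weight lam := by
      ext1 s; simp [G.dilation_mul lam hl]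
    rw [h3] at h1
    have h4 := congrArg (fun A : (Fin n → ℝ) →L[ℝ] (Fin n → ℝ) => A.det) (h1.unique h2)
    have hne : (weightDilationCLM G.weight lam).det ≠ 0 := by
      have : (weightDilationCLM G.weight lam).comp (weightDilationCLM G.weight lam⁻¹) =
          ContinuousLinearMap.id ℝ _ := by
        ext1 x
        simp [coe_weightDilationCLM, weightDilation_mul_mul, (Set.mem_Ioi.1 hl).ne',
          weightDilation_one]
      intro h0
      have h5 := congrArg (fun A : (Fin n → ℝ) →L[ℝ] (Fin n → ℝ) => A.det) this
      simp only [det_comp] at h5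
      rw [h0] at h5
      simp [ContinuousLinearMap.det] at h5
    simp only [det_comp] at h4
    rw [mul_comm] at h4
    exact (mul_right_cancel₀ hne h4).symm
  have hdil : ∀ x : Fin n → ℝ, Continuous fun lam : ℝ => weightDilation G.weight lam x := fun x => by
    unfold weightDilation; fun_prop
  have hdil0 : ∀ x : Fin n → ℝ, weightDilation G.weight 0 x = 0 := fun x => by
    ext l; simp [weightDilation, Nat.one_le_iff_ne_zero.1 (G.weight_pos l)]
  have hc := hJc.comp ((hdil p).prodMk (hdil q))
  have t1 := (hc.tendsto 0).mono_left (nhdsWithin_le_nhds (s := Set.Ioi 0))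
  have t2 : Tendsto (J ∘ fun lam => (weightDilation G.weight lam p, weightDilation G.weight lam q))
      (𝓝[>] 0) (𝓝 (J (p, q))) := tendsto_const_nhds.congr'
    (eventually_nhdsWithin_of_forall fun l hl => (hinv l hl).symm)
  have := tendsto_nhds_unique t2 t1
  simp only [Function.comp_apply, hdil0, Prod.mk_zero_zero, hJ0] at this
  exact this

open MeasureTheory in
theorem volume_image_mul_left (p : Fin n → ℝ) {s : Set (Fin n → ℝ)} (hs : MeasurableSet s) :
    volume (G.mul p '' s) = volume s := by
  have := lintegral_abs_det_fderiv_eq_addHaar_image volume hs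
    (fun x _ => (G.differentiable_mul_left p x).hasFDerivAt.hasFDerivWithinAt)
    (G.mul_left_injective p).injOn
  rw [← this]
  simp [G.det_fderiv_mul_left]

open MeasureTheory in
theorem volume_dualBall_mul (r : ℝ) {lam : ℝ} (hl : 0 < lam) :
    volume (G.dualBall (lam * r)) = ENNReal.ofReal (lam ^ G.homogeneousDim) *
      volume (G.dualBall r) := by
  have himg : G.dualBall (lam * r) = weightDilationCLM G.weight lam '' G.dualBall r := by
    rw [coe_weightDilationCLM]
    ext x
    refine ⟨fun hx => ⟨weightDilation G.weight lam⁻¹ x, ?_, ?_⟩, ?_⟩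
    · have := weightDilation_mem_dualBall (inv_pos.2 hl) hx
      rwa [← mul_assoc, inv_mul_cancel₀ hl.ne', one_mul] at this
    · rw [weightDilation_mul_mul, mul_inv_cancel₀ hl.ne', weightDilation_one]
    · rintro ⟨y, hy, rfl⟩; exact weightDilation_mem_dualBall hl hy
  have hdet : (weightDilationCLM G.weight lam).det = lam ^ G.homogeneousDim := by
    have : (weightDilationCLM G.weight lam : (Fin n → ℝ) →ₗ[ℝ] (Fin n → ℝ)) =
        Matrix.toLin' (Matrix.diagonal fun i => lam ^ G.weight i) := by
      apply LinearMap.ext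
      intro x
      ext i
      simp [weightDilationCLM, Matrix.mulVec_diagonal]
    change LinearMap.det (weightDilationCLM G.weight lam : (Fin n → ℝ) →ₗ[ℝ] (Fin n → ℝ)) = _
    rw [this, LinearMap.det_toLin', Matrix.det_diagonal, Finset.prod_pow_eq_pow_sum]
    rfl
  change LinearMap.det (weightDilationCLM G.weight lam : (Fin n → ℝ) →ₗ[ℝ] (Fin n → ℝ)) = _ at hdet
  rw [himg, Measure.addHaar_image_continuousLinearMap, hdet,
    abs_of_pos (pow_pos hl _)]

end CarnotGroup

/-! ### Greedy selection of vectors, nets, packing bound and cutoff. -/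

/-- Greedy choice of unit vectors, orthogonal to prescribed subspaces and to the vectors chosen at
adjacent indices. -/
theorem exists_unit_vectors_orthogonal_adjacent {ι E : Type*} [NormedAddCommGroup E]
    [InnerProductSpace ℝ E] [FiniteDimensional ℝ E] (adj : ι → ι → Prop)
    (hsymm : ∀ a b, adj a b → adj b a) {m N : ℕ} (hfin : ∀ a, {b | adj a b}.Finite)
    (hcard : ∀ a, {b | adj a b}.ncard ≤ N) (W : ι → Submodule ℝ E)
    (hW : ∀ a, Module.finrank ℝ (W a) ≤ m) (hE : m + N < Module.finrank ℝ E) :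
    ∃ u : ι → E, (∀ a, ‖u a‖ = 1) ∧ (∀ a, u a ∈ (W a)ᗮ) ∧
      ∀ a b, a ≠ b → adj a b → inner ℝ (u a) (u b) = 0 := by
  -- The choice is defined for every `K`, with nothing promised when `K` is too large, so that the
  -- well-founded recursion can be written before its rank bound is known.
  have hsel : ∀ K : Submodule ℝ E, ∃ u : E, Module.finrank ℝ K < Module.finrank ℝ E →
      ‖u‖ = 1 ∧ u ∈ Kᗮ := fun K => by
    by_cases hK : Module.finrank ℝ K < Module.finrank ℝ E
    · have hne : Kᗮ ≠ ⊥ := fun h => by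
        rw [Submodule.orthogonal_eq_bot_iff] at h
        rw [h, finrank_top] at hK
        exact lt_irrefl _ hK
      obtain ⟨x, hx, hx0⟩ := Submodule.exists_mem_ne_zero_of_ne_bot hne
      exact ⟨‖x‖⁻¹ • x, fun _ => ⟨norm_smul_inv_norm hx0, Submodule.smul_mem _ _ hx⟩⟩
    · exact ⟨0, fun h => absurd h hK⟩
  choose sel hsel using hsel
  have hwf : WellFounded (WellOrderingRel (α := ι)) := WellOrderingRel.isWellOrder.wf
  set u : ι → E := hwf.fix fun a f =>
    sel (W a ⊔ Submodule.span ℝ {w | ∃ b, ∃ h : WellOrderingRel b a, adj a b ∧ f b h = w}) with hu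
  have hfix : ∀ a, u a = sel (W a ⊔ Submodule.span ℝ
      (u '' {b | WellOrderingRel b a ∧ adj a b})) := fun a => by
    rw [hu, hwf.fix_eq]
    congr 3
    ext w
    simp only [Set.mem_ofPred_eq, Set.mem_image]
    exact ⟨fun ⟨b, h, hab, e⟩ => ⟨b, ⟨h, hab⟩, e⟩, fun ⟨b, ⟨h, hab⟩, e⟩ => ⟨b, h, hab, e⟩⟩
  have hrank : ∀ a, Module.finrank ℝ ↥(W a ⊔ Submodule.span ℝ
      (u '' {b | WellOrderingRel b a ∧ adj a b})) < Module.finrank ℝ E := fun a => by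
    have hsub : {b | WellOrderingRel b a ∧ adj a b} ⊆ {b | adj a b} := fun b hb => hb.2
    have hf := (hfin a).subset hsub
    have h1 : Module.finrank ℝ ↥(Submodule.span ℝ (u '' {b | WellOrderingRel b a ∧ adj a b})) ≤
        N := by
      have := (hf.image u).fintype
      refine (finrank_span_le_card _).trans ?_
      rw [← Set.ncard_eq_toFinset_card']
      exact (Set.ncard_image_le hf).trans ((Set.ncard_le_ncard hsub (hfin a)).trans (hcard a))
    have h2 := Submodule.finrank_add_le_finrank_add_finrank (W a)
      (Submodule.span ℝ (u '' {b | WellOrderingRel b a ∧ adj a b}))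
    have h3 := hW a
    omega
  have hmem : ∀ a, ‖u a‖ = 1 ∧ u a ∈ (W a ⊔ Submodule.span ℝ
      (u '' {b | WellOrderingRel b a ∧ adj a b}))ᗮ := fun a => by
    have := hsel _ (hrank a)
    rwa [← hfix a] at this
  have hlt : ∀ a b, WellOrderingRel b a → adj a b → inner ℝ (u b) (u a) = 0 := fun a b h hab =>
    (Submodule.mem_orthogonal _ _).1 (hmem a).2 _ (Submodule.mem_sup_right
      (Submodule.subset_span ⟨b, ⟨h, hab⟩, rfl⟩))
  refine ⟨u, fun a => (hmem a).1, fun a => Submodule.orthogonal_le le_sup_left (hmem a).2,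
    fun a b hne hab => ?_⟩
  rcases trichotomous_of WellOrderingRel a b with h | h | h
  · exact hlt b a h (hsymm _ _ hab)
  · exact absurd h hne
  · rw [real_inner_comm]; exact hlt a b h hab

namespace CarnotGroup

variable {n : ℕ} (G : CarnotGroup n)

/-- The points of `P` are pairwise at distance more than `r`. -/
def IsSeparatedAt (r : ℝ) (P : Set (Fin n → ℝ)) : Prop :=
  P.Pairwise fun x y => G.mul (G.inv x) y ∉ G.dualBall r

theorem exists_net {r : ℝ} (hr : 0 ≤ r) : ∃ P : Set (Fin n → ℝ), G.IsSeparatedAt r P ∧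
    ∀ p, ∃ x ∈ P, G.mul (G.inv x) p ∈ G.dualBall r := by
  obtain ⟨P, hP⟩ := zorn_subset {P | G.IsSeparatedAt r P} fun c hc hchain =>
    ⟨⋃₀ c, (Set.pairwise_sUnion hchain.directedOn).2 fun s hs => hc hs,
      fun s hs => Set.subset_sUnion_of_mem hs⟩
  refine ⟨P, hP.prop, fun p => ?_⟩
  by_contra! h
  have hp : p ∉ P := fun hp => h p hp (by rw [G.inv_mul]; exact zero_mem_dualBall hr)
  have hins : G.IsSeparatedAt r (insert p P) :=
    (Set.pairwise_insert_of_notMem hp).2 ⟨hP.prop, fun x hx =>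
      ⟨fun h' => h x hx (inv_mul_mem_dualBall_comm h'), h x hx⟩⟩
  exact hp (hP.le_of_ge hins (Set.subset_insert p P) (Set.mem_insert p P))

variable {G}

open MeasureTheory in
-- Balls of radius `r / 2` about the points are disjoint and lie in the ball of radius `4r + r/2 =
-- 9(r/2)` about `p`; the volume ratio is `9 ^ n_h`.
theorem IsSeparatedAt.card_le {r : ℝ} (hr : 0 < r) {P : Set (Fin n → ℝ)}
    (hP : G.IsSeparatedAt r P) (p : Fin n → ℝ) (t : Finset (Fin n → ℝ))
    (ht : ∀ x ∈ t, x ∈ P ∧ G.mul (G.inv p) x ∈ G.dualBall (4 * r)) :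
    t.card ≤ 9 ^ G.homogeneousDim := by
  have hmeas : MeasurableSet (G.dualBall (r / 2)) := (isClosed_dualBall _).measurableSet
  have hball : ∀ {x z s}, z ∈ G.mul x '' G.dualBall s → G.mul (G.inv x) z ∈ G.dualBall s := by
    rintro x _ s ⟨b, hb, rfl⟩
    rwa [G.inv_mul_cancel_left]
  have hdisj : (t : Set (Fin n → ℝ)).PairwiseDisjoint fun x => G.mul x '' G.dualBall (r / 2) := by
    intro x hx y hy hxy
    refine Set.disjoint_left.2 fun z hz hz' => hP (ht x hx).1 (ht y hy).1 hxy ?_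
    have := inv_mul_mem_dualBall_trans (hball hz) (inv_mul_mem_dualBall_comm (hball hz'))
    rwa [add_halves] at this
  have hmeas' : ∀ x, MeasurableSet (G.mul x '' G.dualBall (r / 2)) := fun x =>
    ((isCompact_dualBall (r / 2)).image (G.continuous_mul_left x)).measurableSet
  have hsub : (⋃ x ∈ t, G.mul x '' G.dualBall (r / 2)) ⊆ G.mul p '' G.dualBall (9 * (r / 2)) := by
    refine Set.iUnion₂_subset fun x hx z hz => ⟨G.mul (G.inv p) z, ?_, G.mul_inv_cancel_left _ _⟩
    have := inv_mul_mem_dualBall_trans (ht x hx).2 (hball hz)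
    exact dualBall_mono (by linarith) this
  have hvol : (t.card : ℝ≥0∞) * volume (G.dualBall (r / 2)) ≤
      (9 ^ G.homogeneousDim : ℕ) * volume (G.dualBall (r / 2)) := by
    calc (t.card : ℝ≥0∞) * volume (G.dualBall (r / 2))
        = ∑ x ∈ t, volume (G.mul x '' G.dualBall (r / 2)) := by
          simp [G.volume_image_mul_left _ hmeas]
      _ = volume (⋃ x ∈ t, G.mul x '' G.dualBall (r / 2)) :=
          (measure_biUnion_finset hdisj fun x _ => hmeas' x).symm
      _ ≤ volume (G.mul p '' G.dualBall (9 * (r / 2))) := measure_mono hsub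
      _ = _ := by
          rw [G.volume_image_mul_left _ (isClosed_dualBall _).measurableSet,
            G.volume_dualBall_mul _ (by norm_num : (0 : ℝ) < 9)]
          congr 1
          rw [ENNReal.ofReal_pow (by norm_num)]
          norm_num
  have h0 : volume (G.dualBall (r / 2)) ≠ 0 :=
    (Measure.measure_pos_of_mem_nhds volume (G.dualBall_mem_nhds (half_pos hr))).ne'
  have htop : volume (G.dualBall (r / 2)) ≠ ⊤ := (isCompact_dualBall _).measure_lt_top.ne
  have := (ENNReal.mul_le_mul_iff_left h0 htop).1 hvol
  exact_mod_cast this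

theorem IsSeparatedAt.finite_and_ncard_le {r : ℝ} (hr : 0 < r) {P : Set (Fin n → ℝ)}
    (hP : G.IsSeparatedAt r P) (p : Fin n → ℝ) :
    {x : P | G.mul (G.inv p) x ∈ G.dualBall (4 * r)}.Finite ∧
      {x : P | G.mul (G.inv p) x ∈ G.dualBall (4 * r)}.ncard ≤ 9 ^ G.homogeneousDim := by
  have hcard : ∀ t : Finset P, (t : Set P) ⊆ {x : P | G.mul (G.inv p) x ∈ G.dualBall (4 * r)} →
      t.card ≤ 9 ^ G.homogeneousDim := fun t ht => by
    rw [← Finset.card_map (Function.Embedding.subtype _)]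
    refine hP.card_le hr p _ fun x hx => ?_
    obtain ⟨y, hy, rfl⟩ := Finset.mem_map.1 hx
    exact ⟨y.2, ht hy⟩
  have hfin : {x : P | G.mul (G.inv p) x ∈ G.dualBall (4 * r)}.Finite := by
    by_contra hinf
    obtain ⟨t, ht, hc⟩ := Set.Infinite.exists_subset_card_eq hinf (9 ^ G.homogeneousDim + 1)
    have := hcard t ht
    omega
  refine ⟨hfin, ?_⟩
  rw [Set.ncard_eq_toFinset_card _ hfin]
  exact hcard _ (by simp)

variable (G)

theorem exists_cutoff : ∃ φ : (Fin n → ℝ) → ℝ, ContDiff ℝ ∞ φ ∧ HasCompactSupport φ ∧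
    (∀ x, φ x ∈ Set.Icc (0 : ℝ) 1) ∧ (∀ x ∈ G.dualBall 1, φ x = 1) ∧
    ∀ x ∉ G.dualBall 2, φ x = 0 := by
  have hint : G.dualBall 1 ⊆ interior (G.dualBall 2) := fun x hx => by
    rw [mem_interior_iff_mem_nhds]
    have h1 : G.mul (G.inv x) ⁻¹' G.dualBall 1 ∈ 𝓝 x :=
      (G.continuous_mul_left (G.inv x)).continuousAt.preimage_mem_nhds
        (by rw [G.inv_mul]; exact G.dualBall_mem_nhds one_pos)
    refine mem_of_superset h1 fun y hy => ?_
    have := mul_mem_dualBall hx hy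
    rw [G.mul_inv_cancel_left] at this
    exact dualBall_mono (by norm_num) this
  obtain ⟨φ, hφ, hr, h0, h1⟩ := exists_contMDiff_zero_iff_one_iff_of_isClosed
    (modelWithCornersSelf ℝ (Fin n → ℝ)) (n := ⊤)
    (isOpen_interior (s := G.dualBall 2)).isClosed_compl
    (isClosed_dualBall (G := G) 1) (Set.disjoint_left.2 fun x hx hx' => hx (hint hx'))
  have hz : ∀ x ∉ G.dualBall 2, φ x = 0 := fun x hx =>
    (h0 x).1 fun h => hx (interior_subset h)
  refine ⟨φ, hφ.contDiff, ?_, fun x => hr ⟨x, rfl⟩, fun x hx => (h1 x).1 hx, hz⟩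
  exact HasCompactSupport.intro (isCompact_dualBall 2) hz

end CarnotGroup

/-! ### Calculus of scaled derivative bounds. -/

/-- Positive scales `S 0 = 1, S 1, …, S j` that are submultiplicative up to total order `j`. -/
structure IsScale (S : ℕ → ℝ) (j : ℕ) : Prop where
  zero : S 0 = 1
  pos : ∀ a, a ≤ j → 0 < S a
  add_le : ∀ a b, a + b ≤ j → S (a + b) ≤ S a * S b

namespace CarnotGroup

variable {n : ℕ} (G : CarnotGroup n)
variable {F : Type*} [NormedAddCommGroup F] [NormedSpace ℝ F]
variable {E : Type*} [NormedAddCommGroup E] [NormedSpace ℝ E]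
variable {H : Type*} [NormedAddCommGroup H] [NormedSpace ℝ H]

/-- `f` is `C^k`, and its horizontal derivatives of order `l ≤ k` are bounded by `A / S (a + l)`. -/
def DerivControl (S : ℕ → ℝ) : ℕ → ℕ → ℝ → ((Fin n → ℝ) → F) → Prop
  | 0, a, A, f => ContDiff ℝ 0 f ∧ ∀ p, S a * ‖f p‖ ≤ A
  | k + 1, a, A, f => ContDiff ℝ (k + 1) f ∧ (∀ p, S a * ‖f p‖ ≤ A) ∧
      ∀ i, DerivControl S k (a + 1) A (G.horizontalDeriv i f)

variable {G} {S : ℕ → ℝ} {j k a : ℕ} {A B : ℝ}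

namespace DerivControl

theorem contDiff {f : (Fin n → ℝ) → F} (h : G.DerivControl S k a A f) : ContDiff ℝ k f := by
  cases k with
  | zero => exact h.1
  | succ k => exact_mod_cast h.1

theorem differentiable {f : (Fin n → ℝ) → F} (h : G.DerivControl S (k + 1) a A f) :
    Differentiable ℝ f := h.contDiff.differentiable (by simp)

theorem bound {f : (Fin n → ℝ) → F} (h : G.DerivControl S k a A f) (p : Fin n → ℝ) :
    S a * ‖f p‖ ≤ A := by
  cases k with
  | zero => exact h.2 p
  | succ k => exact h.2.1 p

theorem nonneg (hS : 0 ≤ S a) {f : (Fin n → ℝ) → F} (h : G.DerivControl S k a A f) : 0 ≤ A :=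
  (mul_nonneg hS (norm_nonneg _)).trans (h.bound 0)

theorem mono (hAB : A ≤ B) {f : (Fin n → ℝ) → F} (h : G.DerivControl S k a A f) :
    G.DerivControl S k a B f := by
  induction k generalizing a f with
  | zero => exact ⟨h.1, fun p => (h.2 p).trans hAB⟩
  | succ k ih => exact ⟨h.1, fun p => (h.2.1 p).trans hAB, fun i => ih (h.2.2 i)⟩

theorem of_succ {f : (Fin n → ℝ) → F} (h : G.DerivControl S (k + 1) a A f) :
    G.DerivControl S k a A f := by
  induction k generalizing a f with
  | zero => exact ⟨h.1.of_le (by simp), h.2.1⟩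
  | succ k ih => exact ⟨h.contDiff.of_le (by norm_cast; omega), h.2.1, fun i => ih (h.2.2 i)⟩

theorem add {f g : (Fin n → ℝ) → F} (hS : ∀ b, b ≤ a + k → 0 ≤ S b)
    (hf : G.DerivControl S k a A f) (hg : G.DerivControl S k a B g) :
    G.DerivControl S k a (A + B) (fun p => f p + g p) := by
  have hb : ∀ p, S a * ‖f p + g p‖ ≤ A + B := fun p => by
    have h1 := mul_le_mul_of_nonneg_left (norm_add_le (f p) (g p)) (hS a (by omega))
    linarith [hf.bound p, hg.bound p]
  induction k generalizing a f g with
  | zero => exact ⟨hf.1.add hg.1, hb⟩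
  | succ k ih =>
    refine ⟨hf.1.add hg.1, hb, fun i => ?_⟩
    have : G.horizontalDeriv i (fun p => f p + g p) =
        fun p => G.horizontalDeriv i f p + G.horizontalDeriv i g p := by
      ext1 p
      simp [horizontalDeriv, fderiv_fun_add (hf.differentiable p) (hg.differentiable p)]
    rw [this]
    refine ih (fun b hb => hS b (by omega)) (hf.2.2 i) (hg.2.2 i) fun p => ?_
    have h1 := mul_le_mul_of_nonneg_left
      (norm_add_le (G.horizontalDeriv i f p) (G.horizontalDeriv i g p)) (hS (a + 1) (by omega))
    linarith [(hf.2.2 i).bound p, (hg.2.2 i).bound p]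

theorem const_smul {f : (Fin n → ℝ) → F} (c : ℝ) (hf : G.DerivControl S k a A f) :
    G.DerivControl S k a (|c| * A) (fun p => c • f p) := by
  have hb : ∀ {b} {g : (Fin n → ℝ) → F}, (∀ p, S b * ‖g p‖ ≤ A) →
      ∀ p, S b * ‖c • g p‖ ≤ |c| * A := fun {b g} h p => by
    have := mul_le_mul_of_nonneg_left (h p) (abs_nonneg c)
    rw [norm_smul, Real.norm_eq_abs]
    linarith
  induction k generalizing a f with
  | zero => exact ⟨hf.1.const_smul c, hb hf.2⟩
  | succ k ih =>
    refine ⟨hf.1.const_smul c, hb hf.2.1, fun i => ?_⟩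
    rw [G.horizontalDeriv_const_smul i c hf.differentiable]
    exact ih (hf.2.2 i)

theorem zero (hA : 0 ≤ A) : G.DerivControl S k a A (fun _ => (0 : F)) := by
  induction k generalizing a with
  | zero => exact ⟨contDiff_const, by simpa using hA⟩
  | succ k ih =>
    refine ⟨contDiff_const, by simpa using hA, fun i => ?_⟩
    have : G.horizontalDeriv i (fun _ => (0 : F)) = fun _ => 0 := by
      ext1 p; simp [horizontalDeriv]
    rw [this]
    exact ih

theorem sum {ι : Type*} (t : Finset ι) {f : ι → (Fin n → ℝ) → F}
    (hS : ∀ b, b ≤ a + k → 0 ≤ S b) (hf : ∀ i ∈ t, G.DerivControl S k a A (f i)) :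
    G.DerivControl S k a (t.card * A) (fun p => ∑ i ∈ t, f i p) := by
  classical
  induction t using Finset.induction_on with
  | empty => simpa using zero le_rfl
  | insert i t hi ih =>
    simp only [Finset.sum_insert hi, Finset.card_insert_of_notMem hi]
    refine ((hf i (Finset.mem_insert_self i t)).add hS
      (ih fun i hi => hf i (Finset.mem_insert_of_mem hi))).mono (le_of_eq ?_)
    push_cast; ring

/-- Leibniz rule: each derivative doubles the number of terms, and submultiplicativity bounds each
term by `A * B`. The offsets `a`, `b` record the derivatives already spent on each factor. -/
theorem bilin (hS : IsScale S j) (L : E →L[ℝ] F →L[ℝ] H) (hL : ∀ x y, ‖L x y‖ ≤ ‖x‖ * ‖y‖)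
    {b : ℕ} {f : (Fin n → ℝ) → E} {g : (Fin n → ℝ) → F} (hj : a + b + k ≤ j)
    (hf : G.DerivControl S k a A f) (hg : G.DerivControl S k b B g) :
    G.DerivControl S k (a + b) (2 ^ k * (A * B)) (fun p => L (f p) (g p)) := by
  have ha0 := (hS.pos a (by omega)).le
  have hb0 := (hS.pos b (by omega)).le
  have hA := hf.nonneg ha0
  have hB := hg.nonneg hb0
  have hbd : ∀ p, S (a + b) * ‖L (f p) (g p)‖ ≤ A * B := fun p => by
    calc S (a + b) * ‖L (f p) (g p)‖ ≤ (S a * S b) * (‖f p‖ * ‖g p‖) :=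
          mul_le_mul (hS.add_le a b (by omega)) (hL _ _) (norm_nonneg _) (mul_nonneg ha0 hb0)
      _ = (S a * ‖f p‖) * (S b * ‖g p‖) := by ring
      _ ≤ A * B := mul_le_mul (hf.bound p) (hg.bound p) (by positivity) hA
  have hle : A * B ≤ 2 ^ k * (A * B) :=
    le_mul_of_one_le_left (mul_nonneg hA hB) (one_le_pow₀ one_le_two)
  have hcd : ContDiff ℝ k (fun p => L (f p) (g p)) :=
    (L.contDiff.comp hf.contDiff).clm_apply hg.contDiff
  induction k generalizing a b f g with
  | zero => exact ⟨hcd, fun p => (hbd p).trans hle⟩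
  | succ k ih =>
    refine ⟨by exact_mod_cast hcd, fun p => (hbd p).trans hle, fun i => ?_⟩
    have hd : G.horizontalDeriv i (fun p => L (f p) (g p)) = fun p =>
        L (G.horizontalDeriv i f p) (g p) + L (f p) (G.horizontalDeriv i g p) := by
      ext1 p
      have h1 := (L.hasFDerivAt.comp p (hf.differentiable p).hasFDerivAt).clm_apply
        (hg.differentiable p).hasFDerivAt
      have h2 : HasFDerivAt (fun p => L (f p) (g p)) _ p := h1
      simp only [horizontalDeriv, h2.fderiv]
      simp [add_comm]
    have key : ∀ {a' b' : ℕ} {f' : (Fin n → ℝ) → E} {g' : (Fin n → ℝ) → F}, a' + b' + k ≤ j →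
        G.DerivControl S k a' A f' → G.DerivControl S k b' B g' →
        G.DerivControl S k (a' + b') (2 ^ k * (A * B)) (fun p => L (f' p) (g' p)) := by
      intro a' b' f' g' hj' hf' hg'
      have ha' := (hS.pos a' (by omega)).le
      refine ih hj' hf' hg' ha' (hS.pos b' (by omega)).le (fun p => ?_)
        (le_mul_of_one_le_left (mul_nonneg hA hB) (one_le_pow₀ one_le_two))
        ((L.contDiff.comp hf'.contDiff).clm_apply hg'.contDiff)
      calc S (a' + b') * ‖L (f' p) (g' p)‖ ≤ (S a' * S b') * (‖f' p‖ * ‖g' p‖) :=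
            mul_le_mul (hS.add_le a' b' (by omega)) (hL _ _) (norm_nonneg _)
              (mul_nonneg ha' (hS.pos b' (by omega)).le)
        _ = (S a' * ‖f' p‖) * (S b' * ‖g' p‖) := by ring
        _ ≤ A * B := mul_le_mul (hf'.bound p) (hg'.bound p)
            (mul_nonneg (hS.pos b' (by omega)).le (norm_nonneg _)) hA
    have h1 := key (a' := a + 1) (b' := b) (by omega) (hf.2.2 i) hg.of_succ
    have h2 := key (a' := a) (b' := b + 1) (by omega) hf.of_succ (hg.2.2 i)
    rw [show a + 1 + b = a + b + 1 by omega] at h1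
    rw [show a + (b + 1) = a + b + 1 by omega] at h2
    rw [hd]
    exact (h1.add (fun c hc => (hS.pos c (by omega)).le) h2).mono (le_of_eq (by ring))

/-- Induction on `k` for all exponents at once, since the derivative of `s ^ q` contains `s ^ (q -
1)`. `C` is chosen before `S` and `s`, which makes the final constant uniform. -/
theorem rpow (j k : ℕ) (A : ℝ) {c : ℝ} (hc : 0 < c) (q : ℝ) : ∃ C : ℝ,
    ∀ (S : ℕ → ℝ) (s : (Fin n → ℝ) → ℝ), IsScale S j → k ≤ j → G.DerivControl S k 0 A s →
      (∀ p, c ≤ s p) → G.DerivControl S k 0 C (fun p => s p ^ q) := by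
  have hb : ∀ (q : ℝ) (k : ℕ) (S : ℕ → ℝ) (s : (Fin n → ℝ) → ℝ), IsScale S j →
      G.DerivControl S k 0 A s → (∀ p, c ≤ s p) → ∀ p, S 0 * ‖s p ^ q‖ ≤ c ^ q + A ^ q := by
    intro q k S s hS hs hcs p
    have hsp : 0 < s p := hc.trans_le (hcs p)
    have hsA : s p ≤ A := by
      have := hs.bound p
      rw [hS.zero, one_mul, Real.norm_eq_abs] at this
      exact (le_abs_self _).trans this
    have hA : 0 < A := hsp.trans_le hsA
    rw [hS.zero, one_mul, Real.norm_of_nonneg (Real.rpow_nonneg hsp.le q)]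
    rcases le_total 0 q with hq | hq
    · linarith [Real.rpow_le_rpow hsp.le hsA hq, Real.rpow_pos_of_pos hc q]
    · linarith [Real.rpow_le_rpow_of_nonpos hc (hcs p) hq, Real.rpow_pos_of_pos hA q]
  have hcd : ∀ (q : ℝ) (k : ℕ) (s : (Fin n → ℝ) → ℝ), ContDiff ℝ k s → (∀ p, c ≤ s p) →
      ContDiff ℝ k (fun p => s p ^ q) := fun q k s hs hcs =>
    hs.rpow_const_of_ne fun p => (hc.trans_le (hcs p)).ne'
  induction k generalizing q with
  | zero =>
    exact ⟨c ^ q + A ^ q, fun S s hS _ hs hcs =>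
      ⟨hcd q 0 s hs.contDiff hcs, hb q 0 S s hS hs hcs⟩⟩
  | succ k ih =>
    obtain ⟨C, hC⟩ := ih (q - 1)
    refine ⟨max (c ^ q + A ^ q) (|q| * (2 ^ k * (C * A))), fun S s hS hkj hs hcs =>
      ⟨by exact_mod_cast hcd q (k + 1) s hs.contDiff hcs,
        fun p => (hb q _ S s hS hs hcs p).trans (le_max_left _ _), fun i => ?_⟩⟩
    have hd : G.horizontalDeriv i (fun p => s p ^ q) = fun p =>
        q • (ContinuousLinearMap.lsmul ℝ ℝ (s p ^ (q - 1)) (G.horizontalDeriv i s p)) := by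
      ext1 p
      have h1 := (hs.differentiable p).hasFDerivAt.rpow_const (p := q)
        (Or.inl (hc.trans_le (hcs p)).ne')
      simp only [horizontalDeriv, h1.fderiv]
      simp [mul_assoc]
    have h1 := hC S s hS (by omega) hs.of_succ hcs
    have h2 := h1.bilin hS (ContinuousLinearMap.lsmul ℝ ℝ)
      (fun x y => by simp) (by omega) (hs.2.2 i)
    rw [zero_add] at h2
    rw [hd]
    simpa using (h2.const_smul q).mono (le_max_right (c ^ q + A ^ q) _)

/-- Each horizontal derivative brings out one factor `ρ⁻¹`; the prefactor `ρ⁻¹ ^ a` keeps the claim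
stable under the induction. -/
theorem comp_dilation_translation {ρ K M : ℝ} (hρ : 0 < ρ) (hK : 0 ≤ K) (y : Fin n → ℝ)
    (hSK : ∀ b, b ≤ j → 0 ≤ S b ∧ S b * ρ⁻¹ ^ b ≤ K) {φ : (Fin n → ℝ) → F} (hj : a + k ≤ j)
    (hφ : G.DerivControl (fun _ => 1) k a M φ) :
    G.DerivControl S k a (K * M)
      (fun p => ρ⁻¹ ^ a • φ (weightDilation G.weight ρ⁻¹ (G.mul y p))) := by
  have hb : ∀ {a k} {φ : (Fin n → ℝ) → F}, a ≤ j → G.DerivControl (fun _ => 1) k a M φ → ∀ p,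
      S a * ‖ρ⁻¹ ^ a • φ (weightDilation G.weight ρ⁻¹ (G.mul y p))‖ ≤ K * M := by
    intro a k φ haj hφ p
    have h1 := hφ.bound (weightDilation G.weight ρ⁻¹ (G.mul y p))
    rw [one_mul] at h1
    rw [norm_smul, Real.norm_of_nonneg (by positivity), ← mul_assoc]
    exact mul_le_mul (hSK a haj).2 h1 (norm_nonneg _) hK
  have hcd : ∀ {a k} {φ : (Fin n → ℝ) → F}, ContDiff ℝ (k : ℕ) φ → ContDiff ℝ k
      (fun p => ρ⁻¹ ^ a • φ (weightDilation G.weight ρ⁻¹ (G.mul y p))) := by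
    intro a k φ hφ
    exact (hφ.comp (((contDiff_weightDilation _ _).comp (G.contDiff_mul_left y)).of_le
      (by exact_mod_cast le_top))).const_smul _
  induction k generalizing a φ with
  | zero => exact ⟨hcd hφ.contDiff, hb (by omega) hφ⟩
  | succ k ih =>
    refine ⟨by exact_mod_cast hcd hφ.contDiff, hb (by omega) hφ, fun i => ?_⟩
    have hd1 : Differentiable ℝ (fun q => φ (weightDilation G.weight ρ⁻¹ q)) :=
      hφ.differentiable.comp ((contDiff_weightDilation _ _).differentiable (by simp))
    have hd2 : Differentiable ℝ (fun q => φ (weightDilation G.weight ρ⁻¹ (G.mul y q))) :=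
      hd1.comp (G.differentiable_mul_left y)
    rw [G.horizontalDeriv_const_smul i _ hd2,
      G.horizontalDeriv_comp_mul_left i hd1 y,
      G.horizontalDeriv_comp_weightDilation i hφ.differentiable (inv_pos.2 hρ)]
    simp only [smul_smul, ← pow_succ]
    exact ih (by omega) (hφ.2.2 i)

theorem exists_of_hasCompactSupport (k a : ℕ) {φ : (Fin n → ℝ) → F} (hφ : ContDiff ℝ ∞ φ)
    (hc : HasCompactSupport φ) : ∃ M, 0 ≤ M ∧ G.DerivControl (fun _ => 1) k a M φ := by
  induction k generalizing a φ with
  | zero =>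
    obtain ⟨C, hC⟩ := hc.exists_bound_of_continuous hφ.continuous
    exact ⟨C, (norm_nonneg _).trans (hC 0), contDiff_zero.2 hφ.continuous,
      fun p => by simpa using hC p⟩
  | succ k ih =>
    obtain ⟨C, hC⟩ := hc.exists_bound_of_continuous hφ.continuous
    have hd : ∀ i, ∃ M, 0 ≤ M ∧ G.DerivControl (fun _ => 1) k (a + 1) M (G.horizontalDeriv i φ) :=
      fun i => ih (a + 1)
        ((hφ.fderiv_right (m := ∞) (by simp)).clm_apply (G.contDiff_leftInvariantField _))
        ((hc.fderiv ℝ).mono fun x hx hx' => hx (by simp [horizontalDeriv, hx']))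
    choose M hM0 hM using hd
    have hs : 0 ≤ ∑ i, M i := Finset.sum_nonneg fun i _ => hM0 i
    have hC0 : 0 ≤ C := (norm_nonneg _).trans (hC 0)
    refine ⟨C + ∑ i, M i, by positivity, hφ.of_le (by exact_mod_cast le_top), fun p => ?_,
      fun i => (hM i).mono ?_⟩
    · rw [one_mul]; linarith [hC p]
    · linarith [Finset.single_le_sum (f := M) (fun i _ => hM0 i) (Finset.mem_univ i)]

/-- At most `N` terms are active at a point. Because `K α` is closed, horizontal derivatives of `φ
α` also vanish off it, so the same sets serve at every order. -/
theorem finsum_smul {ι : Type*} {K : ι → Set (Fin n → ℝ)} (hKc : ∀ α, IsClosed (K α))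
    (hK : LocallyFinite K) {N : ℕ} (hN : ∀ p, {α | p ∈ K α}.ncard ≤ N) {u : ι → F}
    (hu : ∀ α, ‖u α‖ ≤ 1) (hA : 0 ≤ A) (hS : ∀ b, b ≤ a + k → 0 ≤ S b)
    {φ : ι → (Fin n → ℝ) → ℝ} (hφK : ∀ α, ∀ p ∉ K α, φ α p = 0)
    (hφ : ∀ α, G.DerivControl S k a A (φ α)) :
    G.DerivControl S k a (N * A) (fun p => ∑ᶠ α, φ α p • u α) := by
  have hloc : ∀ p, ∃ I : Finset ι, ∀ φ : ι → (Fin n → ℝ) → ℝ, (∀ α, ∀ p ∉ K α, φ α p = 0) →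
      ∀ᶠ q in 𝓝 p, ∑ᶠ α, φ α q • u α = ∑ α ∈ I, φ α q • u α := by
    intro p
    obtain ⟨U, hU, hfin⟩ := hK p
    refine ⟨hfin.toFinset, fun φ hφK => mem_of_superset hU fun q hq => ?_⟩
    refine finsum_eq_sum_of_support_subset _ fun α hα => ?_
    have hqK : q ∈ K α := by
      by_contra h
      exact hα (by simp [hφK α q h])
    simpa using ⟨q, hqK, hq⟩
  have hb : ∀ {a k} {φ : ι → (Fin n → ℝ) → ℝ}, 0 ≤ S a → (∀ α, ∀ p ∉ K α, φ α p = 0) →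
      (∀ α, G.DerivControl S k a A (φ α)) → ∀ p, S a * ‖∑ᶠ α, φ α p • u α‖ ≤ N * A := by
    intro a k φ hSa hφK hφ p
    have hfin : {α | p ∈ K α}.Finite := hK.point_finite p
    rw [finsum_eq_sum_of_support_subset (s := hfin.toFinset) _ fun α hα => by
      by_contra h
      exact hα (by simp [hφK α p (by simpa using h)])]
    calc S a * ‖∑ α ∈ hfin.toFinset, φ α p • u α‖
        ≤ S a * ∑ α ∈ hfin.toFinset, ‖φ α p‖ := by
          refine mul_le_mul_of_nonneg_left ((norm_sum_le _ _).trans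
            (Finset.sum_le_sum fun α _ => ?_)) hSa
          rw [norm_smul]
          exact mul_le_of_le_one_right (norm_nonneg _) (hu α)
      _ = ∑ α ∈ hfin.toFinset, S a * ‖φ α p‖ := Finset.mul_sum _ _ _
      _ ≤ ∑ α ∈ hfin.toFinset, A := Finset.sum_le_sum fun α _ => (hφ α).bound p
      _ = hfin.toFinset.card * A := by simp
      _ ≤ N * A := by
          rw [← Set.ncard_eq_toFinset_card _ hfin]
          exact mul_le_mul_of_nonneg_right (by exact_mod_cast hN p) hA
  have hcd : ∀ {k : ℕ} {φ : ι → (Fin n → ℝ) → ℝ}, (∀ α, ∀ p ∉ K α, φ α p = 0) →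
      (∀ α, ContDiff ℝ k (φ α)) → ContDiff ℝ k (fun p => ∑ᶠ α, φ α p • u α) := by
    intro k φ hφK hφ
    refine contDiff_iff_contDiffAt.2 fun p => ?_
    obtain ⟨I, hI⟩ := hloc p
    exact (ContDiff.sum fun α _ =>
      (hφ α).smul contDiff_const).contDiffAt.congr_of_eventuallyEq (hI φ hφK)
  induction k generalizing a φ with
  | zero => exact ⟨hcd hφK fun α => (hφ α).contDiff, hb (hS a (by omega)) hφK hφ⟩
  | succ k ih =>
    refine ⟨by exact_mod_cast hcd hφK fun α => (hφ α).contDiff, hb (hS a (by omega)) hφK hφ,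
      fun i => ?_⟩
    have hφK' : ∀ α, ∀ p ∉ K α, G.horizontalDeriv i (φ α) p = 0 := fun α p hp => by
      have : φ α =ᶠ[𝓝 p] fun _ => 0 :=
        mem_of_superset ((hKc α).isOpen_compl.mem_nhds hp) fun q hq => hφK α q hq
      simp [horizontalDeriv, this.fderiv_eq]
    have hd : G.horizontalDeriv i (fun p => ∑ᶠ α, φ α p • u α) =
        fun p => ∑ᶠ α, G.horizontalDeriv i (φ α) p • u α := by
      ext1 p
      obtain ⟨I, hI⟩ := hloc p
      have h1 : HasFDerivAt (fun q => ∑ α ∈ I, φ α q • u α) _ p :=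
        HasFDerivAt.fun_sum fun α _ => ((hφ α).differentiable p).hasFDerivAt.smul_const (u α)
      have h2 : (fun q => ∑ᶠ α, φ α q • u α) =ᶠ[𝓝 p] fun q => ∑ α ∈ I, φ α q • u α := hI φ hφK
      rw [(hI _ hφK').self_of_nhds]
      simp only [horizontalDeriv, h2.fderiv_eq, h1.fderiv]
      simp
    rw [hd]
    exact ih (fun b hb => hS b (by omega)) hφK' fun α => (hφ α).2.2 i

end DerivControl

end CarnotGroup

theorem IsLogConcaveScales.isScale {R : ℕ → ℝ} {j : ℕ} (hR : IsLogConcaveScales R j) :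
    IsScale (fun a => if a = 0 then 1 else R a) j where
  zero := by simp
  pos a ha := by
    by_cases h : a = 0
    · simp [h]
    · simpa [h] using hR.1 a (Nat.one_le_iff_ne_zero.2 h) ha
  add_le a b hab := by
    by_cases ha : a = 0
    · simp [ha]
    · by_cases hb : b = 0
      · simp [hb]
      · simpa [ha, hb] using
          hR.2 a b (Nat.one_le_iff_ne_zero.2 ha) (Nat.one_le_iff_ne_zero.2 hb) hab

/-- Ties all scales to the first, so that bumps of the single width `ε * S 1` are controlled at
every order. -/
theorem IsScale.le_pow {S : ℕ → ℝ} {j : ℕ} (hS : IsScale S j) {b : ℕ} (hb : b ≤ j) :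
    S b ≤ S 1 ^ b := by
  induction b with
  | zero => simp [hS.zero]
  | succ b ih =>
    rw [pow_succ]
    exact (hS.add_le b 1 hb).trans
      (mul_le_mul_of_nonneg_right (ih (by omega)) (hS.pos 1 (by omega)).le)

/-! ### Projection off an orthonormal system. -/

section Orthonormal

variable {E : Type*} [NormedAddCommGroup E] [InnerProductSpace ℝ E]

theorem Orthonormal.fin_snoc {m : ℕ} {v : Fin m → E} (hv : Orthonormal ℝ v) {w : E}
    (hw : ‖w‖ = 1) (hvw : ∀ i, inner ℝ (v i) w = 0) :
    Orthonormal ℝ (Fin.snoc v w : Fin (m + 1) → E) := by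
  refine ⟨fun i => ?_, fun i j hij => ?_⟩
  · refine Fin.lastCases ?_ (fun i => ?_) i
    · simpa using hw
    · simpa using hv.1 i
  · induction i using Fin.lastCases with
    | last =>
      induction j using Fin.lastCases with
      | last => exact absurd rfl hij
      | cast j =>
        simp only [Fin.snoc_last, Fin.snoc_castSucc]
        rw [real_inner_comm]; exact hvw j
    | cast i =>
      induction j using Fin.lastCases with
      | last => simpa using hvw i
      | cast j => simpa using hv.2 fun h => hij (by rw [h])

theorem Orthonormal.inner_sub_sum {m : ℕ} {v : Fin m → E} (hv : Orthonormal ℝ v) (x : E)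
    (i : Fin m) : inner ℝ (v i) (x - ∑ l, inner ℝ x (v l) • v l) = 0 := by
  rw [inner_sub_right, hv.inner_right_fintype, real_inner_comm, sub_self]

/-- By Pythagoras the projection removes at most `m * (1 / (2m)) ^ 2 ≤ 1/4` of the squared length.
-/
theorem Orthonormal.half_le_inner_self {m : ℕ} (hm : 1 ≤ m) {v : Fin m → E}
    (hv : Orthonormal ℝ v) {x : E} (hx : 1 ≤ inner ℝ x x)
    (hxv : ∀ i, |inner ℝ x (v i)| ≤ 1 / (2 * m)) :
    1 / 2 ≤ inner ℝ (x - ∑ l, inner ℝ x (v l) • v l) (x - ∑ l, inner ℝ x (v l) • v l) := by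
  have h1 : inner ℝ (∑ l, inner ℝ x (v l) • v l) (x - ∑ l, inner ℝ x (v l) • v l) = 0 := by
    rw [sum_inner]
    refine Finset.sum_eq_zero fun i _ => ?_
    rw [real_inner_smul_left, hv.inner_sub_sum, mul_zero]
  have hm' : (1 : ℝ) ≤ m := by exact_mod_cast hm
  have h2 : ∑ l, inner ℝ x (v l) * inner ℝ x (v l) ≤ 1 / 4 := by
    calc ∑ l, inner ℝ x (v l) * inner ℝ x (v l) ≤ ∑ _l : Fin m, (1 / (2 * (m : ℝ))) ^ 2 := by
          refine Finset.sum_le_sum fun l _ => ?_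
          rw [← sq, ← sq_abs]
          exact pow_le_pow_left₀ (abs_nonneg _) (hxv l) 2
      _ = 1 / 4 * (1 / m) := by
          simp; field_simp; norm_num
      _ ≤ 1 / 4 := by
          have : 1 / (m : ℝ) ≤ 1 := by rw [div_le_one (by positivity)]; exact hm'
          linarith
  rw [inner_sub_left, h1, inner_sub_right, inner_sum]
  simp only [real_inner_smul_right]
  linarith

end Orthonormal

/-! ### Passage between `scaledNorm` and `DerivControl`. -/

namespace CarnotGroup

variable {n : ℕ} {G : CarnotGroup n}
variable {F : Type*} [NormedAddCommGroup F] [NormedSpace ℝ F]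

/-- `wordDeriv` unfolds at the outermost derivative, `DerivControl` at the innermost; this
reconciles them. -/
theorem wordDeriv_succ_last {k : ℕ} (I : Fin (k + 1) → G.HorizontalIndex) (f : (Fin n → ℝ) → F) :
    G.wordDeriv I f =
      G.wordDeriv (fun l => I l.castSucc) (G.horizontalDeriv (I (Fin.last k)) f) := by
  induction k with
  | zero => rfl
  | succ k ih =>
    have h := ih (fun l => I l.succ)
    simp only [wordDeriv] at h ⊢
    rw [h]
    rfl

variable {S : ℕ → ℝ} {j k a : ℕ} {A : ℝ}

theorem DerivControl.wordDeriv_le {f : (Fin n → ℝ) → F} (hf : G.DerivControl S k a A f) {l : ℕ}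
    (hl : l ≤ k) (I : Fin l → G.HorizontalIndex) (p : Fin n → ℝ) :
    S (a + l) * ‖G.wordDeriv I f p‖ ≤ A := by
  induction l generalizing k a f with
  | zero => exact hf.bound p
  | succ l ih =>
    obtain ⟨k, rfl⟩ : ∃ k', k = k' + 1 := ⟨k - 1, by omega⟩
    rw [wordDeriv_succ_last, show a + (l + 1) = a + 1 + l by omega]
    exact ih (hf.2.2 _) (by omega) _

theorem derivControl_of_wordDeriv_le {f : (Fin n → ℝ) → F} (hf : ContDiff ℝ k f)
    (h : ∀ l ≤ k, ∀ (I : Fin l → G.HorizontalIndex) p, S (a + l) * ‖G.wordDeriv I f p‖ ≤ A) :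
    G.DerivControl S k a A f := by
  induction k generalizing a f with
  | zero => exact ⟨hf, fun p => h 0 le_rfl Fin.elim0 p⟩
  | succ k ih =>
    refine ⟨by exact_mod_cast hf, fun p => h 0 (by omega) Fin.elim0 p, fun i =>
      ih (G.contDiff_horizontalDeriv i (by exact_mod_cast hf)) fun l hl I p => ?_⟩
    have := h (l + 1) (by omega) (Fin.snoc I i) p
    rw [wordDeriv_succ_last, show a + (l + 1) = a + 1 + l by omega] at this
    simpa using this

theorem le_gradNorm {l : ℕ} (I : Fin l → G.HorizontalIndex) (f : (Fin n → ℝ) → F)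
    (p : Fin n → ℝ) : ‖G.wordDeriv I f p‖ ≤ G.gradNorm l f p :=
  Real.le_sqrt_of_sq_le (Finset.single_le_sum (f := fun I => ‖G.wordDeriv I f p‖ ^ 2)
    (fun _ _ => sq_nonneg _) (Finset.mem_univ I))

theorem mul_wordDeriv_le_of_scaledNorm_le {R : ℕ → ℝ} (hR : ∀ l, 1 ≤ l → l ≤ j → 0 < R l)
    {f : (Fin n → ℝ) → F} (hf : G.scaledNorm R j f ≤ 1) {l : ℕ} (h1 : 1 ≤ l) (hl : l ≤ j)
    (I : Fin l → G.HorizontalIndex) (p : Fin n → ℝ) : R l * ‖G.wordDeriv I f p‖ ≤ 1 := by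
  have h2 : ENNReal.ofReal (R l) * ENNReal.ofReal (G.gradNorm l f p) ≤ 1 := by
    refine le_trans ?_ hf
    refine le_trans ?_ (Finset.single_le_sum
      (f := fun k => ENNReal.ofReal (R k) * G.supGradNorm k f) (fun _ _ => zero_le)
      (Finset.mem_Icc.2 ⟨h1, hl⟩))
    gcongr
    exact le_iSup (fun p => ENNReal.ofReal (G.gradNorm l f p)) p
  rw [← ENNReal.ofReal_mul (hR l h1 hl).le, ENNReal.ofReal_le_one] at h2
  exact (mul_le_mul_of_nonneg_left (le_gradNorm I f p) (hR l h1 hl).le).trans h2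

theorem DerivControl.scaledNorm_le {R : ℕ → ℝ} (hR : ∀ l, 1 ≤ l → l ≤ j → 0 < R l)
    (hSR : ∀ l, 1 ≤ l → S l = R l) {f : (Fin n → ℝ) → F} (hA : 0 ≤ A)
    (hf : G.DerivControl S j 0 A f) : G.scaledNorm R j f ≤
      ((∑ l ∈ Finset.Icc 1 j, √(Fintype.card (Fin l → G.HorizontalIndex)) * A).toNNReal : ℝ≥0) := by
  change _ ≤ ENNReal.ofReal _
  rw [ENNReal.ofReal_sum_of_nonneg fun _ _ => by positivity]
  refine Finset.sum_le_sum fun l hl => ?_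
  obtain ⟨h1, h2⟩ := Finset.mem_Icc.1 hl
  have hRl := hR l h1 h2
  rw [supGradNorm, ENNReal.mul_iSup]
  refine iSup_le fun p => ?_
  rw [← ENNReal.ofReal_mul hRl.le]
  refine ENNReal.ofReal_le_ofReal ?_
  have hw : ∀ I : Fin l → G.HorizontalIndex, ‖G.wordDeriv I f p‖ ≤ A / R l := fun I => by
    have := hf.wordDeriv_le h2 I p
    rw [zero_add, hSR l h1] at this
    rw [le_div_iff₀ hRl]; linarith
  have hg : G.gradNorm l f p ≤ √(Fintype.card (Fin l → G.HorizontalIndex)) * (A / R l) := by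
    rw [gradNorm, ← Real.sqrt_sq (div_nonneg hA hRl.le), ← Real.sqrt_mul (Nat.cast_nonneg _)]
    refine Real.sqrt_le_sqrt ?_
    calc ∑ I : Fin l → G.HorizontalIndex, ‖G.wordDeriv I f p‖ ^ 2
        ≤ ∑ _I : Fin l → G.HorizontalIndex, (A / R l) ^ 2 :=
          Finset.sum_le_sum fun I _ => pow_le_pow_left₀ (norm_nonneg _) (hw I) 2
      _ = _ := by simp
  calc R l * G.gradNorm l f p
      ≤ R l * (√(Fintype.card (Fin l → G.HorizontalIndex)) * (A / R l)) :=
        mul_le_mul_of_nonneg_left hg hRl.le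
    _ = _ := by field_simp

/-- The function `c * ⟨u, v⟩` is itself a test function for the dual distance. -/
theorem abs_inner_sub_le {E : Type*} [NormedAddCommGroup E] [InnerProductSpace ℝ E] {c r : ℝ}
    (hc : 0 < c) {v : (Fin n → ℝ) → E} (hv : ContDiff ℝ 1 v)
    (hvb : ∀ i p, c * ‖G.horizontalDeriv i v p‖ ≤ 1) {u : E} (hu : ‖u‖ ≤ 1) {x p : Fin n → ℝ}
    (hp : G.mul (G.inv x) p ∈ G.dualBall r) :
    |inner ℝ u (v p) - inner ℝ u (v x)| ≤ r / c := by
  have hL : G.IsHorizontallyLipschitz (fun q => c * inner ℝ u (v q)) := by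
    refine ⟨contDiff_const.mul (contDiff_const.inner ℝ hv), fun i q => ?_⟩
    have h1 := ((innerSL ℝ u).hasFDerivAt.comp q
      (hv.differentiable (by simp) q).hasFDerivAt).const_mul c
    have h2 : HasFDerivAt (fun q => c * inner ℝ u (v q)) _ q := h1
    have h3 : G.horizontalDeriv i (fun q => c * inner ℝ u (v q)) q =
        c * inner ℝ u (G.horizontalDeriv i v q) := by
      simp [horizontalDeriv, h2.fderiv]
    rw [h3, abs_mul, abs_of_pos hc]
    refine le_trans (mul_le_mul_of_nonneg_left ?_ hc.le) (hvb i q)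
    exact (abs_real_inner_le_norm _ _).trans (mul_le_of_le_one_left (norm_nonneg _) hu)
  have := hL.abs_sub_le (p := x) hp
  rw [G.mul_inv_cancel_left, ← mul_sub, abs_mul, abs_of_pos hc] at this
  rw [le_div_iff₀ hc]; linarith

end CarnotGroup

/-! ### Construction of the almost orthogonal field. -/

namespace CarnotGroup

variable {n : ℕ} {G : CarnotGroup n} {S : ℕ → ℝ} {j : ℕ}
variable {E : Type*} [NormedAddCommGroup E] [InnerProductSpace ℝ E]

/-- A vector field of length at least one, with controlled derivatives, that is almost orthogonal
to a given orthonormal system with controlled derivatives. -/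
theorem exists_almost_orthogonal_field [FiniteDimensional ℝ E] (hS : IsScale S j) (hj : 1 ≤ j)
    {φ : (Fin n → ℝ) → ℝ} {M : ℝ} (hM0 : 0 ≤ M) (hM : G.DerivControl (fun _ => 1) j 0 M φ)
    (hφI : ∀ x, φ x ∈ Set.Icc (0 : ℝ) 1) (hφ1 : ∀ x ∈ G.dualBall 1, φ x = 1)
    (hφ0 : ∀ x ∉ G.dualBall 2, φ x = 0) {ε : ℝ} (hε : 0 < ε) (hε1 : ε ≤ 1) {m : ℕ}
    (hE : m + 9 ^ G.homogeneousDim < Module.finrank ℝ E) {v : Fin m → (Fin n → ℝ) → E}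
    (hv : ∀ i, G.DerivControl S j 0 1 (v i)) :
    ∃ x : (Fin n → ℝ) → E,
      G.DerivControl S j 0 ((9 ^ G.homogeneousDim : ℕ) * (ε⁻¹ ^ j * M)) x ∧
      ∀ p, 1 ≤ inner ℝ (x p) (x p) ∧
        ∀ i, |inner ℝ (x p) (v i p)| ≤ (9 ^ G.homogeneousDim : ℕ) * (2 * ε) := by
  set N := 9 ^ G.homogeneousDim with hN
  have hS1 : 0 < S 1 := hS.pos 1 hj
  set ρ := ε * S 1 with hρdef
  have hρ : 0 < ρ := mul_pos hε hS1
  obtain ⟨P, hP, hcov⟩ := G.exists_net hρ.le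
  have hcard := hP.finite_and_ncard_le hρ
  -- The bumps live on balls of radius `2 * ρ`, so two that overlap have centres within `4 * ρ`.
  obtain ⟨u, hu1, huW, hu⟩ := exists_unit_vectors_orthogonal_adjacent (E := E)
    (fun x y : P => G.mul (G.inv x) y ∈ G.dualBall (4 * ρ))
    (fun x y h => inv_mul_mem_dualBall_comm h)
    (fun x => (hcard x).1) (fun x => (hcard x).2)
    (fun x => Submodule.span ℝ (Set.range fun i => v i x))
    (fun x => by simpa [Set.finrank] using finrank_range_le_card (R := ℝ) (fun i => v i x)) hE
  set K : P → Set (Fin n → ℝ) := fun α => {p | G.mul (G.inv α) p ∈ G.dualBall (2 * ρ)} with hKdef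
  have hKc : ∀ α, IsClosed (K α) := fun α =>
    (isClosed_dualBall _).preimage (G.continuous_mul_left _)
  have hKsub : ∀ p, {α | p ∈ K α} ⊆ {x : P | G.mul (G.inv p) x ∈ G.dualBall (4 * ρ)} :=
    fun p α hα => dualBall_mono (by linarith) (inv_mul_mem_dualBall_comm hα)
  have hKN : ∀ p, {α | p ∈ K α}.ncard ≤ N := fun p =>
    (Set.ncard_le_ncard (hKsub p) (hcard p).1).trans (hcard p).2
  have hKlf : LocallyFinite K := fun p => by
    refine ⟨G.mul (G.inv p) ⁻¹' G.dualBall ρ,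
      (G.continuous_mul_left _).continuousAt.preimage_mem_nhds
        (by rw [G.inv_mul]; exact G.dualBall_mem_nhds hρ), (hcard p).1.subset ?_⟩
    rintro α ⟨q, hq, hq'⟩
    exact dualBall_mono (by linarith) (inv_mul_mem_dualBall_trans hq' (inv_mul_mem_dualBall_comm hq))
  set ψ : P → (Fin n → ℝ) → ℝ := fun α p =>
    φ (weightDilation G.weight ρ⁻¹ (G.mul (G.inv α) p)) with hψ
  have hψK : ∀ α, ∀ p ∉ K α, ψ α p = 0 := fun α p hp => hφ0 _ fun h => hp <| by
    have : (2 : ℝ) = ρ⁻¹ * (2 * ρ) := by field_simp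
    rw [this] at h
    exact (weightDilation_mem_dualBall_iff (inv_pos.2 hρ)).1 h
  have hψ1 : ∀ (α : P) p, G.mul (G.inv α) p ∈ G.dualBall ρ → ψ α p = 1 := fun α p hp => hφ1 _ <| by
    have := weightDilation_mem_dualBall (inv_pos.2 hρ) hp
    rwa [inv_mul_cancel₀ hρ.ne'] at this
  have hSK : ∀ b, b ≤ j → 0 ≤ S b ∧ S b * ρ⁻¹ ^ b ≤ ε⁻¹ ^ j := fun b hb => by
    refine ⟨(hS.pos b hb).le, ?_⟩
    calc S b * ρ⁻¹ ^ b ≤ S 1 ^ b * ρ⁻¹ ^ b :=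
          mul_le_mul_of_nonneg_right (hS.le_pow hb) (by positivity)
      _ = ε⁻¹ ^ b := by rw [← mul_pow, hρdef]; congr 1; field_simp
      _ ≤ ε⁻¹ ^ j := pow_le_pow_right₀ ((one_le_inv₀ hε).2 hε1) hb
  have hψC : ∀ α, G.DerivControl S j 0 (ε⁻¹ ^ j * M) (ψ α) := fun α => by
    have := hM.comp_dilation_translation hρ (by positivity) (G.inv α) hSK (by omega)
    simpa using this
  refine ⟨fun p => ∑ᶠ α, ψ α p • u α, DerivControl.finsum_smul hKc hKlf hKN
    (fun α => (hu1 α).le) (by positivity) (fun b hb => (hS.pos b (by omega)).le) hψK hψC,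
    fun p => ?_⟩
  have hfin : {α | p ∈ K α}.Finite := hKlf.point_finite p
  have hsum : ∑ᶠ α, ψ α p • u α = ∑ α ∈ hfin.toFinset, ψ α p • u α :=
    finsum_eq_sum_of_support_subset _ fun α hα => by
      by_contra h
      exact hα (by simp [hψK α p (by simpa using h)])
  have hIK : ∀ {α}, α ∈ hfin.toFinset → p ∈ K α := fun h => by simpa using h
  simp only [hsum]
  constructor
  · obtain ⟨x, hx, hxp⟩ := hcov p
    have hxI : (⟨x, hx⟩ : P) ∈ hfin.toFinset := by
      simpa [hKdef] using dualBall_mono (by linarith) hxp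
    -- All `α` in the sum have `p` in their supports, hence are pairwise adjacent and have
    -- orthonormal `u α`.
    have h1 : inner ℝ (∑ α ∈ hfin.toFinset, ψ α p • u α) (∑ α ∈ hfin.toFinset, ψ α p • u α) =
        ∑ α ∈ hfin.toFinset, ψ α p ^ 2 := by
      rw [sum_inner]
      refine Finset.sum_congr rfl fun α hα => ?_
      rw [inner_sum, Finset.sum_eq_single_of_mem α hα]
      · rw [real_inner_smul_left, real_inner_smul_right, real_inner_self_eq_norm_sq, hu1]; ring
      · intro β hβ hne
        rw [real_inner_smul_left, real_inner_smul_right, hu α β hne.symm]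
        · simp
        · exact dualBall_mono (by linarith)
            (inv_mul_mem_dualBall_trans (hIK hα) (inv_mul_mem_dualBall_comm (hIK hβ)))
    rw [h1]
    calc (1 : ℝ) = ψ ⟨x, hx⟩ p ^ 2 := by rw [hψ1 ⟨x, hx⟩ p hxp]; norm_num
      _ ≤ _ := Finset.single_le_sum (f := fun α => ψ α p ^ 2) (fun _ _ => sq_nonneg _) hxI
  · intro i
    rw [sum_inner]
    have hvi : ∀ i' q, S 1 * ‖G.horizontalDeriv i' (v i) q‖ ≤ 1 := fun i' q => by
      obtain ⟨j, rfl⟩ : ∃ j', j = j' + 1 := ⟨j - 1, by omega⟩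
      simpa using ((hv i).2.2 i').bound q
    -- `u α` is orthogonal to `v i` at the centre, and `⟨u α, v i⟩` varies by at most `2ρ / S 1 =
    -- 2ε` over the support.
    have hterm : ∀ α ∈ hfin.toFinset, |inner ℝ (ψ α p • u α) (v i p)| ≤ 2 * ε := fun α hα => by
      have h0 : inner ℝ (u α) (v i α) = 0 := by
        rw [real_inner_comm]
        exact (Submodule.mem_orthogonal _ _).1 (huW α) _ (Submodule.subset_span ⟨i, rfl⟩)
      have h1 := abs_inner_sub_le hS1 ((hv i).contDiff.of_le (by exact_mod_cast hj)) hvi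
        (hu1 α).le (hIK hα)
      rw [h0, sub_zero, hρdef, show 2 * (ε * S 1) / S 1 = 2 * ε by field_simp] at h1
      rw [real_inner_smul_left, abs_mul, abs_of_nonneg (hφI _).1]
      exact (mul_le_of_le_one_left (abs_nonneg _) (hφI _).2).trans h1
    calc |∑ α ∈ hfin.toFinset, inner ℝ (ψ α p • u α) (v i p)|
        ≤ ∑ α ∈ hfin.toFinset, 2 * ε :=
          (Finset.abs_sum_le_sum_abs _ _).trans (Finset.sum_le_sum hterm)
      _ = hfin.toFinset.card * (2 * ε) := by simp
      _ ≤ N * (2 * ε) := by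
          rw [← Set.ncard_eq_toFinset_card _ hfin]
          exact mul_le_mul_of_nonneg_right (by exact_mod_cast hKN p) (by positivity)

theorem DerivControl.real_inner (hS : IsScale S j) {A B : ℝ} {f g : (Fin n → ℝ) → E}
    (hf : G.DerivControl S j 0 A f) (hg : G.DerivControl S j 0 B g) :
    G.DerivControl S j 0 (2 ^ j * (A * B)) (fun p => inner ℝ (f p) (g p)) :=
  hf.bilin hS (innerSL ℝ) (fun x y => norm_inner_le_norm x y) (by omega) hg

theorem DerivControl.smul (hS : IsScale S j) {A B : ℝ} {f : (Fin n → ℝ) → ℝ} {g : (Fin n → ℝ) → E}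
    (hf : G.DerivControl S j 0 A f) (hg : G.DerivControl S j 0 B g) :
    G.DerivControl S j 0 (2 ^ j * (A * B)) (fun p => f p • g p) :=
  hf.bilin hS (ContinuousLinearMap.lsmul ℝ ℝ) (fun x y => by simp [norm_smul]) (by omega) hg

theorem DerivControl.sub_sum_inner_smul (hS : IsScale S j) {A : ℝ} {x : (Fin n → ℝ) → E}
    (hx : G.DerivControl S j 0 A x) {m : ℕ} {v : Fin m → (Fin n → ℝ) → E}
    (hv : ∀ i, G.DerivControl S j 0 1 (v i)) :
    G.DerivControl S j 0 (A + m * (2 ^ j * (2 ^ j * A)))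
      (fun p => x p - ∑ i, inner ℝ (x p) (v i p) • v i p) := by
  have hS0 : ∀ b, b ≤ 0 + j → 0 ≤ S b := fun b hb => (hS.pos b (by omega)).le
  have h1 : ∀ i, G.DerivControl S j 0 (2 ^ j * (2 ^ j * A))
      (fun p => inner ℝ (x p) (v i p) • v i p) := fun i => by
    simpa using (hx.real_inner hS (hv i)).smul hS (hv i)
  have h2 := hx.add hS0 ((DerivControl.sum Finset.univ hS0 fun i _ => h1 i).const_smul (-1))
  simpa [sub_eq_add_neg] using h2

end CarnotGroup

/-- The assumed codimension exceeds the packing bound; `d ≥ 1` matters because the right side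
vanishes at `d = 0`. -/
theorem nine_pow_lt_of_one_le {d : ℕ} (hd : 1 ≤ d) : 9 ^ d < 2 ^ (4 * d + 7) * d := by
  have h1 : 9 ^ d ≤ 16 ^ d := Nat.pow_le_pow_left (by norm_num) d
  have h2 : 0 < 16 ^ d := by positivity
  rw [pow_add, pow_mul]
  norm_num
  nlinarith

end

theorem theorem4p3 {n : ℕ} (hn : 1 ≤ n) (G : CarnotGroup n) (m j : ℕ) (hm : 1 ≤ m) (hj : 1 ≤ j) :
    ∃ C : ℝ≥0, ∀ (D : ℕ), m + 2 ^ (4 * G.homogeneousDim + 7) * G.homogeneousDim ≤ D →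
      ∀ R : ℕ → ℝ, IsLogConcaveScales R j →
      ∀ v : Fin m → (Fin n → ℝ) → EuclideanSpace ℝ (Fin D),
        (∀ i, ContDiff ℝ j (v i)) →
        (∀ p, Orthonormal ℝ (fun i => v i p)) →
        (∀ i, G.scaledNorm R j (v i) ≤ 1) →
        ∃ w : (Fin n → ℝ) → EuclideanSpace ℝ (Fin D),
          ContDiff ℝ j w ∧
          (∀ p, Orthonormal ℝ
            (Fin.snoc (fun i => v i p) (w p) : Fin (m + 1) → EuclideanSpace ℝ (Fin D))) ∧
          G.scaledNorm R j w ≤ (C : ℝ≥0∞) := by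

  have hd : 1 ≤ G.homogeneousDim :=
    (G.weight_pos ⟨0, hn⟩).trans (Finset.single_le_sum (f := G.weight) (fun _ _ => Nat.zero_le _)
      (Finset.mem_univ _))
  obtain ⟨φ, hφ, hφc, hφI, hφ1, hφ0⟩ := G.exists_cutoff
  obtain ⟨M, hM0, hM⟩ := CarnotGroup.DerivControl.exists_of_hasCompactSupport (G := G) j 0 hφ hφc
  set N : ℕ := 9 ^ G.homogeneousDim with hN
  have hN1 : (1 : ℝ) ≤ N := by exact_mod_cast Nat.one_le_pow _ _ (by norm_num)
  have hm1 : (1 : ℝ) ≤ m := by exact_mod_cast hm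
  -- Chosen so that `N * (2 * ε) = 1 / (2 * m)`, the threshold in `half_le_inner_self`.
  set ε : ℝ := 1 / (4 * N * m) with hε
  have hNm : 1 ≤ (N : ℝ) * m := one_le_mul_of_one_le_of_one_le hN1 hm1
  have hε0 : 0 < ε := by positivity
  have hε1 : ε ≤ 1 := by rw [hε, div_le_one (by positivity)]; linarith
  set A₁ : ℝ := N * (ε⁻¹ ^ j * M)
  set A₂ : ℝ := A₁ + m * (2 ^ j * (2 ^ j * A₁))
  -- The normalising factor is written `⟨y, y⟩ ^ (-1/2)`, with `⟨y, y⟩ ≥ 1/2` and control `2 ^ j *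
  -- (A₂ * A₂)` from the bilinear bound.
  obtain ⟨C, hC⟩ := CarnotGroup.DerivControl.rpow (G := G) j j (2 ^ j * (A₂ * A₂))
    (one_half_pos (α := ℝ)) (-(1 / 2))
  refine ⟨(∑ l ∈ Finset.Icc 1 j,
    √(Fintype.card (Fin l → G.HorizontalIndex)) * (2 ^ j * (C * A₂))).toNNReal,
    fun D hD R hR v hv hvo hvR => ?_⟩
  -- Setting `S 0 = 1` puts the bound `‖v i‖ ≤ 1` on the same footing as the derivative bounds,
  -- whatever the value of `R 0`.
  set S : ℕ → ℝ := fun a => if a = 0 then 1 else R a with hSdef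
  have hS : IsScale S j := hR.isScale
  have hSR : ∀ l, 1 ≤ l → S l = R l := fun l hl => by simp [hSdef, Nat.one_le_iff_ne_zero.1 hl]
  have hvC : ∀ i, G.DerivControl S j 0 1 (v i) := fun i =>
    CarnotGroup.derivControl_of_wordDeriv_le (hv i) fun l hl I p => by
      rw [zero_add]
      rcases Nat.eq_zero_or_pos l with rfl | h
      · rw [hS.zero, one_mul]
        exact ((hvo p).1 i).le
      · rw [hSR l h]
        exact CarnotGroup.mul_wordDeriv_le_of_scaledNorm_le hR.1 (hvR i) h hl I p
  have hdim : m + N < Module.finrank ℝ (EuclideanSpace ℝ (Fin D)) := by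
    rw [finrank_euclideanSpace_fin]
    have := nine_pow_lt_of_one_le hd
    omega
  obtain ⟨x, hxC, hx⟩ := CarnotGroup.exists_almost_orthogonal_field hS hj hM0 hM hφI hφ1 hφ0 hε0 hε1
    hdim hvC
  set y : (Fin n → ℝ) → EuclideanSpace ℝ (Fin D) :=
    fun p => x p - ∑ i, inner ℝ (x p) (v i p) • v i p with hy
  have hyC : G.DerivControl S j 0 A₂ y := hxC.sub_sum_inner_smul hS hvC
  have hy2 : ∀ p, 1 / 2 ≤ inner ℝ (y p) (y p) := fun p =>
    (hvo p).half_le_inner_self hm (hx p).1 fun i => ((hx p).2 i).trans (le_of_eq (by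
      rw [← hN, hε]; field_simp; norm_num))
  have hwC := (hC S _ hS le_rfl (hyC.real_inner hS hyC) hy2).smul hS hyC
  refine ⟨_, hwC.contDiff, fun p => (hvo p).fin_snoc ?_ fun i => ?_,
    hwC.scaledNorm_le hR.1 hSR (hwC.nonneg (by simp [hS.zero]))⟩
  · have hpos : 0 < ‖y p‖ := by
      rw [norm_pos_iff]
      intro h
      have := hy2 p
      rw [h, inner_zero_left] at this
      norm_num at this
    rw [real_inner_self_eq_norm_sq, Real.rpow_neg (by positivity), ← Real.sqrt_eq_rpow,
      Real.sqrt_sq hpos.le]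
    exact norm_smul_inv_norm (𝕜 := ℝ) (norm_pos_iff.1 hpos)
  · rw [real_inner_smul_right, hy, (hvo p).inner_sub_sum, mul_zero]
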